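/- Let $n\in\mathbb N$, $n\ge 1$, $Y=(0,1)^n$. Let $A\in L^\infty_{\mathrm{per}}(Y;\mathbb R^{n\times n}_{\mathrm{sym}})$ and $b\in L^\infty_{\mathrm{per}}(Y;\mathbb R^n)$ ($Y$-periodic) satisfy $\lambda I_n\le A\le\Lambda I_n$ a.e. for some $\lambda,\Lambda>0$, and, for some $\delta\in\left(\frac{n}{n+\pi^2},1\right]$, $$\frac{|A|^2+|b|^2}{(\operatorname{tr}A)^2}\le\frac1{n-1+\delta}\quad\text{a.e.},$$ where $|A|$ is the Frobenius norm. Set $\gamma:=\frac{\operatorname{tr}A}{|A|^2+|b|^2}$, $\tilde A:=\gamma A$, $\tilde b:=\gamma b$, and let $F\in L^2_{\mathrm{per}}(Y;\mathbb R^n)$. Let $H^1_{\mathrm{per},0}(Y;\mathbb R^n)$ be the space of $Y$-periodic $H^1$ vector fields with mean zero over $Y$ (with the $H^1(Y)$-norm), and for $v,w$ in it let $$B_2(v,w):=\int_Y(\nabla\cdot v)\,(\tilde A:Dw+\tilde b\cdot w)+\frac12\int_Y\left(Dv-(Dv)^{\mathrm T}\right):\left(Dw-(Dw)^{\mathrm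 T}\right).$$ There is a unique $\tilde\rho_0\in H^1_{\mathrm{per},0}(Y;\mathbb R^n)$ with $B_2(\tilde\rho_0,w)=-\int_YF\cdot w$ for all $w\in H^1_{\mathrm{per},0}(Y;\mathbb R^n)$. There is a unique $\tilde u_0\in L^2_{\mathrm{per}}(Y)$ solving $$-D^2:(\tilde A\tilde u_0)+\nabla\cdot(\tilde b\tilde u_0)=\nabla\cdot F\ \text{ in }Y,\qquad \tilde u_0\ \text{is $Y$-periodic},\qquad \int_Y\tilde u_0=0,$$ in the very weak sense, that is, $\int_Y\tilde u_0=0$ and $\int_Y\tilde u_0(\tilde A:D^2\varphi+\tilde b\cdot\nabla\varphi)=\int_YF\cdot\nabla\varphi$ for all $\varphi\in H^2_{\mathrm{per}}(Y)$; moreover $\tilde u_0=-\nabla\cdot\tilde\rho_0$. Let $P_h$ be any closed linear subspace of $H^1_{\mathrm{per},0}(Y;\mathbb R^n)$. Then there is a unique $\tilde\rho_h\in P_h$ such that $B_2(\tilde\rho_h,w_h)=-\int_YF\cdot w_h$ for all $w_h\in P_h$, and $\tilde u_h:=-\nabla\cdot\tilde\rho_h\in L^2_{\mathrm{per}}(Y)$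 satisfies $$\|\tilde u_0-\tilde u_h\|_{L^2(Y)}\le C\inf_{w_h\in P_h}\|D(\tilde\rho_0-w_h)\|_{L^2(Y;\mathbb R^{n\times n})}$$ for some constant $C>0$ depending only on $\lambda,\Lambda,\delta,n$. -/

import Mathlib

open MeasureTheory
open scoped ContDiff

noncomputable section

namespace FPK

/-- Vectors in `ℝⁿ` with the Euclidean norm. -/
abbrev Vec (n : ℕ) := EuclideanSpace ℝ (Fin n)

/-- Real `n × n` matrices as a Euclidean space, i.e. with the Frobenius norm and inner product. -/
abbrev Mat (n : ℕ) := EuclideanSpace ℝ (Fin n × Fin n)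

/-- The unit cell `Y = (0,1)ⁿ`. -/
def Y (n : ℕ) : Set (Fin n → ℝ) := Set.univ.pi fun _ => Set.Ioo 0 1

/-- Lebesgue measure on the unit cell. -/
def μY (n : ℕ) : Measure (Fin n → ℝ) := volume.restrict (Y n)

/-- `L²_per(Y; E)`: a `Y`-periodic function is identified with its restriction to the cell `Y`
(every element of `L²(Y; E)` has a unique `Y`-periodic extension to `ℝⁿ`). -/
abbrev L2per (n : ℕ) (E : Type) [NormedAddCommGroup E] := Lp E 2 (μY n)

/-- Smooth `Y`-periodic functions on `ℝⁿ`. -/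
structure IsTest {n : ℕ} (φ : (Fin n → ℝ) → ℝ) : Prop where
  smooth : ContDiff ℝ ∞ φ
  periodic : ∀ (k : Fin n → ℤ) (x : Fin n → ℝ), φ (fun i => x i + (k i : ℝ)) = φ x

/-- The classical partial derivative `∂_j φ`. -/
def partialDeriv {n : ℕ} (j : Fin n) (φ : (Fin n → ℝ) → ℝ) (x : Fin n → ℝ) : ℝ :=
  fderiv ℝ φ x (Pi.single j 1)

/-- `v = ∂_j u` weakly, in the sense of periodic distributions: the test functions are
all smooth `Y`-periodic functions, so that no jumps of `u` across `∂Y` are allowed. -/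
def HasWeakPartial {n : ℕ} (j : Fin n) (u v : (Fin n → ℝ) → ℝ) : Prop :=
  ∀ φ : (Fin n → ℝ) → ℝ, IsTest φ →
    ∫ x, u x * partialDeriv j φ x ∂(μY n) = -∫ x, v x * φ x ∂(μY n)

/-- `g = ∇φ` weakly, for scalar `φ`. -/
def HasWeakGrad {n : ℕ} (φ : L2per n ℝ) (g : L2per n (Vec n)) : Prop :=
  ∀ j, HasWeakPartial j (fun x => φ x) (fun x => g x j)

/-- `G = Dw` weakly, for vector-valued `w`: `G_{ij} = ∂_j w_i`. -/
def HasWeakJac {n : ℕ} (w : L2per n (Vec n)) (G : L2per n (Mat n)) : Prop :=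
  ∀ i j, HasWeakPartial j (fun x => w x i) (fun x => G x (i, j))

section helpers

variable {n : ℕ}

instance instFiniteμY : IsFiniteMeasure (μY n) := by
  refine ⟨?_⟩
  rw [μY, Measure.restrict_apply_univ]
  refine lt_of_le_of_lt (measure_mono (t := Set.Icc (0 : Fin n → ℝ) 1) ?_)
    isCompact_Icc.measure_lt_top
  intro x hx
  exact ⟨fun i => (hx i trivial).1.le, fun i => (hx i trivial).2.le⟩

theorem memLp_of_continuous {f : (Fin n → ℝ) → ℝ} (hf : Continuous f) : MemLp f 2 (μY n) := by
  obtain ⟨C, hC⟩ := (isCompact_Icc (a := (0 : Fin n → ℝ)) (b := 1)).exists_bound_of_continuousOn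
    hf.continuousOn
  refine MemLp.of_bound hf.aestronglyMeasurable C ?_
  have hY : MeasurableSet (Y n) := MeasurableSet.univ_pi fun _ => measurableSet_Ioo
  rw [μY]
  filter_upwards [ae_restrict_mem hY] with x hx
  exact hC x ⟨fun i => (hx i trivial).1.le, fun i => (hx i trivial).2.le⟩

theorem IsTest.continuous_partialDeriv {φ : (Fin n → ℝ) → ℝ} (h : IsTest φ) (j : Fin n) :
    Continuous (partialDeriv j φ) :=
  (h.smooth.continuous_fderiv (by simp)).clm_apply continuous_const

theorem memLp_coord {ι : Type} [Fintype ι] (w : L2per n (EuclideanSpace ℝ ι)) (i : ι) :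
    MemLp (fun x => w x i) 2 (μY n) :=
  (EuclideanSpace.proj (𝕜 := ℝ) i).comp_memLp' (Lp.memLp w)

theorem HasWeakPartial.congr {j : Fin n} {u u' v v' : (Fin n → ℝ) → ℝ}
    (h : HasWeakPartial j u v) (hu : u' =ᵐ[μY n] u) (hv : v' =ᵐ[μY n] v) :
    HasWeakPartial j u' v' := by
  intro φ hφ
  have h1 : ∫ x, u' x * partialDeriv j φ x ∂(μY n) = ∫ x, u x * partialDeriv j φ x ∂(μY n) :=
    integral_congr_ae (by filter_upwards [hu] with x hx; rw [hx])
  have h2 : ∫ x, v' x * φ x ∂(μY n) = ∫ x, v x * φ x ∂(μY n) :=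
    integral_congr_ae (by filter_upwards [hv] with x hx; rw [hx])
  rw [h1, h2, h φ hφ]

theorem HasWeakPartial.add {j : Fin n} {u u' v v' : (Fin n → ℝ) → ℝ}
    (h : HasWeakPartial j u v) (h' : HasWeakPartial j u' v')
    (hu : MemLp u 2 (μY n)) (hu' : MemLp u' 2 (μY n))
    (hv : MemLp v 2 (μY n)) (hv' : MemLp v' 2 (μY n)) :
    HasWeakPartial j (fun x => u x + u' x) (fun x => v x + v' x) := by
  intro φ hφ
  have hd := memLp_of_continuous (hφ.continuous_partialDeriv j)
  have hc := memLp_of_continuous hφ.smooth.continuous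
  have h1 : ∫ x, (u x + u' x) * partialDeriv j φ x ∂(μY n) =
      (∫ x, u x * partialDeriv j φ x ∂(μY n)) + ∫ x, u' x * partialDeriv j φ x ∂(μY n) := by
    simp only [add_mul]
    exact integral_add (hu.integrable_mul hd) (hu'.integrable_mul hd)
  have h2 : ∫ x, (v x + v' x) * φ x ∂(μY n) =
      (∫ x, v x * φ x ∂(μY n)) + ∫ x, v' x * φ x ∂(μY n) := by
    simp only [add_mul]
    exact integral_add (hv.integrable_mul hc) (hv'.integrable_mul hc)
  rw [h1, h2, h φ hφ, h' φ hφ]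
  ring

theorem HasWeakPartial.const_mul {j : Fin n} {u v : (Fin n → ℝ) → ℝ} (c : ℝ)
    (h : HasWeakPartial j u v) :
    HasWeakPartial j (fun x => c * u x) (fun x => c * v x) := by
  intro φ hφ
  simp only [mul_assoc]
  rw [integral_const_mul, integral_const_mul, h φ hφ]
  ring

end helpers

/-- `H¹_{per,0}(Y; ℝⁿ)`: the mean-zero `w ∈ L²_per(Y; ℝⁿ)` with a weak Jacobian in
`L²_per(Y; ℝ^{n×n})`. A function is stored together with its (unique) weak Jacobian, as the pair
`(w, Dw)`, so that the norm inherited from `L² × L²` is the `H¹(Y)`-norm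
`(‖w‖² + ‖Dw‖²)^{1/2}`. -/
def H1per0 (n : ℕ) : Submodule ℝ (WithLp 2 (L2per n (Vec n) × L2per n (Mat n))) where
  carrier := {p | HasWeakJac p.fst p.snd ∧ ∫ x, p.fst x ∂(μY n) = 0}
  add_mem' := by
    rintro p q ⟨hp, hp0⟩ ⟨hq, hq0⟩
    refine ⟨fun i j => ?_, ?_⟩
    · refine ((hp i j).add (hq i j) (memLp_coord _ _) (memLp_coord _ _)
        (memLp_coord _ _) (memLp_coord _ _)).congr ?_ ?_
      · filter_upwards [Lp.coeFn_add p.fst q.fst] with x hx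
        rw [WithLp.add_fst, hx]
        rfl
      · filter_upwards [Lp.coeFn_add p.snd q.snd] with x hx
        rw [WithLp.add_snd, hx]
        rfl
    · rw [WithLp.add_fst, integral_congr_ae (Lp.coeFn_add p.fst q.fst)]
      simp only [Pi.add_apply]
      rw [integral_add ((Lp.memLp p.fst).integrable (by norm_num))
        ((Lp.memLp q.fst).integrable (by norm_num)), hp0, hq0, add_zero]
  zero_mem' := by
    refine ⟨fun i j => ?_, ?_⟩
    · have h0 : HasWeakPartial j (fun _ : Fin n → ℝ => (0 : ℝ)) (fun _ => 0) := by
        intro φ _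
        simp
      refine h0.congr ?_ ?_
      · filter_upwards [Lp.coeFn_zero (Vec n) 2 (μY n)] with x hx
        rw [WithLp.zero_fst, hx]
        rfl
      · filter_upwards [Lp.coeFn_zero (Mat n) 2 (μY n)] with x hx
        rw [WithLp.zero_snd, hx]
        rfl
    · rw [WithLp.zero_fst, integral_congr_ae (Lp.coeFn_zero (Vec n) 2 (μY n))]
      simp
  smul_mem' := by
    rintro c p ⟨hp, hp0⟩
    refine ⟨fun i j => ?_, ?_⟩
    · refine ((hp i j).const_mul c).congr ?_ ?_
      · filter_upwards [Lp.coeFn_smul c p.fst] with x hx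
        rw [WithLp.smul_fst, hx]
        rfl
      · filter_upwards [Lp.coeFn_smul c p.snd] with x hx
        rw [WithLp.smul_snd, hx]
        rfl
    · rw [WithLp.smul_fst, integral_congr_ae (Lp.coeFn_smul c p.fst)]
      simp only [Pi.smul_apply]
      rw [integral_smul, hp0, smul_zero]

/-- The underlying function of `w ∈ H¹_{per,0}(Y; ℝⁿ)`. -/
def fn {n : ℕ} (w : H1per0 n) : L2per n (Vec n) := w.1.fst

/-- The weak Jacobian `Dw`. -/
def D {n : ℕ} (w : H1per0 n) : L2per n (Mat n) := w.1.snd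

/-- The trace of a matrix. -/
def trL (n : ℕ) : Mat n →L[ℝ] ℝ := ∑ i : Fin n, EuclideanSpace.proj (i, i)

/-- The divergence `∇·w ∈ L²_per(Y)`, the trace of `Dw`. -/
def div {n : ℕ} (w : H1per0 n) : L2per n ℝ := (trL n).compLp (D w)

/-- The Frobenius product `M : N = ∑ M_{ij} N_{ij}`. -/
def frob {n : ℕ} (M N : Matrix (Fin n) (Fin n) ℝ) : ℝ := ∑ i, ∑ j, M i j * N i j

/-- An element of `Mat n` as a matrix. -/
def toMatrix {n : ℕ} (G : Mat n) : Matrix (Fin n) (Fin n) ℝ := Matrix.of fun i j => G (i, j)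

/-- `f ∈ L^∞_per(Y)`, as an essentially bounded function on `ℝⁿ` that is `Y`-periodic. -/
def IsLinftyPer {n : ℕ} (f : (Fin n → ℝ) → ℝ) : Prop :=
  MemLp f ⊤ volume ∧ ∀ k : Fin n → ℤ, ∀ᵐ x : Fin n → ℝ, f (fun i => x i + (k i : ℝ)) = f x

/-- The Cordes-type setting `ℬ`, with ellipticity constants `lam`, `Lam` and Cordes
parameter `δ`. -/
structure SettingB {n : ℕ} (lam Lam δ : ℝ) (A : (Fin n → ℝ) → Matrix (Fin n) (Fin n) ℝ)
    (b : (Fin n → ℝ) → Vec n) : Prop where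
  linfty_A : ∀ i j, IsLinftyPer fun x => A x i j
  linfty_b : ∀ i, IsLinftyPer fun x => b x i
  symm : ∀ᵐ x, (A x).IsSymm
  lam_pos : 0 < lam
  Lam_pos : 0 < Lam
  elliptic : ∀ᵐ x, ∀ ξ : Fin n → ℝ,
    lam * (ξ ⬝ᵥ ξ) ≤ ξ ⬝ᵥ (A x).mulVec ξ ∧ ξ ⬝ᵥ (A x).mulVec ξ ≤ Lam * (ξ ⬝ᵥ ξ)
  lt_δ : (n : ℝ) / (n + Real.pi ^ 2) < δ
  δ_le : δ ≤ 1
  cordes : ∀ᵐ x, (frob (A x) (A x) + ‖b x‖ ^ 2) / (A x).trace ^ 2 ≤ 1 / ((n : ℝ) - 1 + δ)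

section operators

variable {n : ℕ} (A : (Fin n → ℝ) → Matrix (Fin n) (Fin n) ℝ) (b : (Fin n → ℝ) → Vec n)

/-- The renormalization function `γ = tr(A) / (|A|² + |b|²)`. -/
def gam (x : Fin n → ℝ) : ℝ := (A x).trace / (frob (A x) (A x) + ‖b x‖ ^ 2)

/-- `Ã = γA`. -/
def Atil (x : Fin n → ℝ) : Matrix (Fin n) (Fin n) ℝ := gam A b x • A x

/-- `b̃ = γb`. -/
def btil (x : Fin n → ℝ) : Vec n := gam A b x • b x

/-- `Ã : G + b̃ · g` -/
def renOp (g : L2per n (Vec n)) (G : L2per n (Mat n)) (x : Fin n → ℝ) : ℝ :=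
  frob (Atil A b x) (toMatrix (G x)) + inner ℝ (btil A b x) (g x)

/-- The bilinear form
`B₂(v,w) = ∫_Y (∇·v)(Ã:Dw + b̃·w) + ½ ∫_Y (Dv - (Dv)ᵀ) : (Dw - (Dw)ᵀ)`. -/
def B2 (v w : H1per0 n) : ℝ :=
  (∫ x, div v x * renOp A b (fn w) (D w) x ∂(μY n)) +
    (1 / 2) * ∫ x, frob (toMatrix (D v x) - (toMatrix (D v x)).transpose)
      (toMatrix (D w x) - (toMatrix (D w x)).transpose) ∂(μY n)

/-- `ρ ∈ P` and `B₂(ρ,w) = -∫_Y F·w` for all `w ∈ P`. -/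
def IsVarSol (F : L2per n (Vec n)) (P : Submodule ℝ (H1per0 n)) (ρ : H1per0 n) : Prop :=
  ρ ∈ P ∧ ∀ w ∈ P, B2 A b ρ w = -∫ x, inner ℝ (F x) (fn w x) ∂(μY n)

/-- `u ∈ L²_per(Y)` is a very weak solution of `-D²:(Ãu) + ∇·(b̃u) = ∇·F`, `∫_Y u = 0`:
`∫_Y u (Ã:D²φ + b̃·∇φ) = ∫_Y F·∇φ` for all `φ ∈ H²_per(Y)`. Here `g = ∇φ` and `H = D²φ`. -/
def IsVeryWeakSol (F : L2per n (Vec n)) (u : L2per n ℝ) : Prop :=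
  (∀ (φ : L2per n ℝ) (g : L2per n (Vec n)) (H : L2per n (Mat n)),
    HasWeakGrad φ g → HasWeakJac g H →
      ∫ x, u x * renOp A b g H x ∂(μY n) = ∫ x, inner ℝ (F x) (g x) ∂(μY n)) ∧
  ∫ x, u x ∂(μY n) = 0

end operators

end FPK

end

/-! The renormalization by `γ` makes `Ã:G + b̃·g` a small perturbation of the trace. Pointwise `|Ã -
I|² + |b̃|² = n - (tr A)²/(|A|² + |b|²) ≤ 1 - δ`, so by Poincaré's inequality the operator `w ↦ Ã:Dw
+ b̃·w - ∇·w` has `L²` norm at most `κ‖Dw‖`, where `κ² = (1 - δ)(1 + n/π²)`. The lower bound on `δ`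
says precisely that `κ < 1`.

For periodic fields `∫ ∂_i v_i ∂_j w_j = ∫ ∂_j v_i ∂_i w_j`, hence the skew term of `B₂` equals `∫
Dv:Dw - ∫ (∇·v)(∇·w)`, and `B₂` is the Dirichlet form plus `∫ (∇·v)` times the perturbation
(`SettingB.B2_eq`). As `‖∇·v‖ ≤ ‖Dv‖`, it is bounded by `1 + κ` and coercive with constant `1 - κ`
in the seminorm `‖D·‖`. Lax–Milgram gives the variational solutions in any closed subspace, and
Céa's lemma gives the error bound with constant `(1 + κ)/(1 - κ)`.

Testing with `w = ∇φ` turns the Dirichlet term into `∫ (∇·v)Δφ`, so `-∇·ρ₀` is a very weak solution.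
For uniqueness, a difference `u` of two such solutions satisfies `|⟨u, Δψ⟩| ≤ κ‖u‖‖Δψ‖` for smooth
periodic `ψ`. These Laplacians are dense among mean-zero functions, so `‖u‖² ≤ κ‖u‖²` and `u = 0`.
-/

namespace FPK

open scoped ComplexConjugate

noncomputable section

/-! ### Fourier coefficients on the unit cell and Parseval's identity. -/

section Fourier

variable {n : ℕ}

/-- The normalized Haar measure on the torus. -/
def torusMeasure (n : ℕ) : Measure (UnitAddTorus (Fin n)) :=
  Measure.pi fun _ => AddCircle.haarAddCircle

/-- The section of the covering `ℝⁿ → ℝⁿ/ℤⁿ` with values in `(0,1]ⁿ`. -/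
def torusSection (x : UnitAddTorus (Fin n)) : Fin n → ℝ :=
  (UnitAddTorus.measurableEquivPiIoc (0 : Fin n → ℝ) x).1

theorem coe_torusSection (x : UnitAddTorus (Fin n)) (i : Fin n) :
    ((torusSection x i : ℝ) : UnitAddCircle) = x i :=
  (AddCircle.equivIoc 1 0).symm_apply_apply (x i)

theorem measurableSet_unitIoc :
    MeasurableSet {x : Fin n → ℝ | ∀ i, x i ∈ Set.Ioc ((0 : Fin n → ℝ) i) ((0 : Fin n → ℝ) i + 1)} :=
  MeasurableSet.univ_pi' fun _ => measurableSet_Ioc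

theorem measurableEmbedding_torusSection :
    MeasurableEmbedding (torusSection : UnitAddTorus (Fin n) → Fin n → ℝ) :=
  (MeasurableEmbedding.subtype_coe measurableSet_unitIoc).comp
    (UnitAddTorus.measurableEquivPiIoc (0 : Fin n → ℝ)).measurableEmbedding

theorem Y_ae_eq_unitIoc :
    Y n =ᵐ[volume] {x : Fin n → ℝ | ∀ i, x i ∈ Set.Ioc ((0 : Fin n → ℝ) i) ((0 : Fin n → ℝ) i + 1)} := by
  have h1 := Measure.univ_pi_Ioo_ae_eq_Icc (μ := fun _ : Fin n => (volume : Measure ℝ))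
    (f := fun _ => 0) (g := fun _ => 1)
  have h2 := Measure.univ_pi_Ioc_ae_eq_Icc (μ := fun _ : Fin n => (volume : Measure ℝ))
    (f := fun _ => 0) (g := fun _ => 1)
  have h := h1.trans h2.symm
  rw [← volume_pi] at h
  have e : {x : Fin n → ℝ | ∀ i, x i ∈ Set.Ioc ((0 : Fin n → ℝ) i) ((0 : Fin n → ℝ) i + 1)} =
      Set.univ.pi fun _ => Set.Ioc 0 1 := by
    ext x
    simp
  rw [e]
  exact h

theorem measurePreserving_torusSection :
    MeasurePreserving (torusSection : UnitAddTorus (Fin n) → Fin n → ℝ) (torusMeasure n) (μY n) := by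
  have h := UnitAddTorus.measurePreserving_equivPiIoc (0 : Fin n → ℝ)
  have h2 : MeasurePreserving (Subtype.val : {x : Fin n → ℝ // ∀ i, x i ∈
      Set.Ioc ((0 : Fin n → ℝ) i) ((0 : Fin n → ℝ) i + 1)} → Fin n → ℝ)
      (Measure.comap Subtype.val volume) (μY n) := by
    refine ⟨measurable_subtype_coe, ?_⟩
    rw [μY, Measure.restrict_congr_set Y_ae_eq_unitIoc]
    exact map_comap_subtype_coe measurableSet_unitIoc _
  exact h2.comp h

/-- The character `x ↦ exp(2πi k·x)`. -/
def char (k : Fin n → ℤ) (x : Fin n → ℝ) : ℂ :=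
  Complex.exp (2 * Real.pi * Complex.I * ∑ i, (k i : ℂ) * (x i : ℂ))

theorem mFourier_eq_char (k : Fin n → ℤ) (t : UnitAddTorus (Fin n)) :
    UnitAddTorus.mFourier k t = char k (torusSection t) := by
  simp only [UnitAddTorus.mFourier, ContinuousMap.coe_mk, char, Finset.mul_sum, Complex.exp_sum]
  refine Finset.prod_congr rfl fun i _ => ?_
  rw [← coe_torusSection t i, fourier_coe_apply]
  congr 1
  push_cast
  ring

/-- The Fourier coefficient `∫_Y u(x) exp(-2πi k·x) dx`. -/
def fhat (u : (Fin n → ℝ) → ℝ) (k : Fin n → ℤ) : ℂ :=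
  ∫ x, conj (char k x) * (u x : ℂ) ∂(μY n)

/-- Parseval's identity on the torus, transported along the measure-preserving section. Later
integral identities and estimates reduce through it to comparing coefficients for each frequency. -/
theorem hasSum_fhat_mul {u v : (Fin n → ℝ) → ℝ} (hu : MemLp u 2 (μY n)) (hv : MemLp v 2 (μY n)) :
    HasSum (fun k => conj (fhat u k) * fhat v k) ((∫ x, u x * v x ∂(μY n) : ℝ) : ℂ) := by
  have hmp := measurePreserving_torusSection (n := n)
  have key : ∀ w : (Fin n → ℝ) → ℝ, MemLp w 2 (μY n) →
      ∃ W : Lp ℂ 2 (torusMeasure n), (W =ᵐ[torusMeasure n] fun t => (w (torusSection t) : ℂ)) ∧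
        ∀ k, UnitAddTorus.mFourierCoeff W k = fhat w k := by
    intro w hw
    have h1 : MemLp (fun t => (w (torusSection t) : ℂ)) 2 (torusMeasure n) :=
      (hw.comp_measurePreserving hmp).ofReal
    refine ⟨h1.toLp _, h1.coeFn_toLp, fun k => ?_⟩
    rw [fhat, ← hmp.integral_comp measurableEmbedding_torusSection]
    refine integral_congr_ae ?_
    filter_upwards [h1.coeFn_toLp] with t ht
    rw [UnitAddTorus.mFourier_neg, mFourier_eq_char, smul_eq_mul]
    exact congrArg _ ht
  obtain ⟨U, hU, hU'⟩ := key u hu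
  obtain ⟨V, hV, hV'⟩ := key v hv
  have h := UnitAddTorus.hasSum_prod_mFourierCoeff U V
  have h' : HasSum (fun k => conj (fhat u k) * fhat v k)
      (∫ t, conj (U t) * V t ∂(torusMeasure n)) :=
    h.congr_fun fun k => (congrArg₂ (fun a b => conj a * b) (hU' k) (hV' k)).symm
  convert h' using 1
  rw [← hmp.integral_comp measurableEmbedding_torusSection, ← integral_complex_ofReal]
  refine integral_congr_ae ?_
  filter_upwards [hU, hV] with t h1 h2
  rw [h1, h2]
  simp

theorem ae_eq_zero_of_fhat_eq_zero {u : (Fin n → ℝ) → ℝ} (hu : MemLp u 2 (μY n))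
    (h : ∀ k, fhat u k = 0) : u =ᵐ[μY n] 0 := by
  have h1 := hasSum_fhat_mul hu hu
  simp only [h, mul_zero] at h1
  have h2 : ∫ x, u x * u x ∂(μY n) = 0 := by exact_mod_cast h1.unique hasSum_zero
  rw [integral_eq_zero_iff_of_nonneg (fun x => mul_self_nonneg _) (hu.integrable_mul hu)] at h2
  filter_upwards [h2] with x hx
  simpa using hx

end Fourier

/-! ### Smooth periodic test functions and the Fourier symbol of a weak derivative. -/

section TestFunctions

variable {n : ℕ}

theorem IsTest.differentiable {φ : (Fin n → ℝ) → ℝ} (h : IsTest φ) : Differentiable ℝ φ :=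
  h.smooth.differentiable (by simp)

theorem IsTest.mul {φ ψ : (Fin n → ℝ) → ℝ} (hφ : IsTest φ) (hψ : IsTest ψ) :
    IsTest (fun x => φ x * ψ x) :=
  ⟨hφ.smooth.mul hψ.smooth, fun k x => by simp only [hφ.periodic k x, hψ.periodic k x]⟩

theorem isTest_one : IsTest (fun _ : Fin n → ℝ => (1 : ℝ)) :=
  ⟨contDiff_const, fun _ _ => rfl⟩

theorem partialDeriv_one (j : Fin n) : partialDeriv j (fun _ : Fin n → ℝ => (1 : ℝ)) = 0 := by
  ext x
  simp [partialDeriv]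

theorem IsTest.partialDeriv_mul {φ ψ : (Fin n → ℝ) → ℝ} (hφ : IsTest φ) (hψ : IsTest ψ)
    (j : Fin n) (x : Fin n → ℝ) :
    partialDeriv j (fun x => φ x * ψ x) x = φ x * partialDeriv j ψ x + partialDeriv j φ x * ψ x := by
  simp only [partialDeriv]
  rw [fderiv_fun_mul (hφ.differentiable x) (hψ.differentiable x)]
  simp [mul_comm]

theorem IsTest.isTest_partialDeriv {φ : (Fin n → ℝ) → ℝ} (hφ : IsTest φ) (j : Fin n) :
    IsTest (partialDeriv j φ) := by
  refine ⟨(hφ.smooth.fderiv_right (m := ∞) (by simp)).clm_apply contDiff_const, fun k x => ?_⟩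
  have h : (fun y : Fin n → ℝ => φ (y + fun i => (k i : ℝ))) = φ := funext fun y => hφ.periodic k y
  have h2 := fderiv_comp_add_right (𝕜 := ℝ) (f := φ) (x := x) (fun i => (k i : ℝ))
  rw [h] at h2
  simp only [partialDeriv]
  rw [h2]
  rfl

/-- The divergence theorem on the cube for the field `φ e_j`: the contributions of opposite faces
cancel by periodicity. -/
theorem IsTest.integral_partialDeriv {φ : (Fin n → ℝ) → ℝ} (hφ : IsTest φ) (j : Fin n) :
    ∫ x, partialDeriv j φ x ∂(μY n) = 0 := by
  obtain _ | m := n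
  · exact j.elim0
  have h1 := Measure.univ_pi_Ioo_ae_eq_Icc (μ := fun _ : Fin (m + 1) => (volume : Measure ℝ))
    (f := fun _ => 0) (g := fun _ => 1)
  rw [← volume_pi] at h1
  rw [μY, Y, Measure.restrict_congr_set h1]
  have h := integral_divergence_of_hasFDerivAt_off_countable' (fun _ : Fin (m + 1) => (0 : ℝ))
    (fun _ => 1) (fun _ => zero_le_one) (fun i => if i = j then φ else 0)
    (fun i => if i = j then fderiv ℝ φ else 0) ∅ Set.countable_empty ?_ ?_ ?_
  · have e : ∀ x, ∑ i, (if i = j then fderiv ℝ φ else 0) x (Pi.single i 1) = partialDeriv j φ x := by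
      intro x
      rw [Finset.sum_eq_single j]
      · simp [partialDeriv]
      · intro i _ hi
        simp [hi]
      · simp
    simp only [e] at h
    rw [h]
    refine Finset.sum_eq_zero fun i _ => ?_
    by_cases hi : i = j
    · subst hi
      rw [sub_eq_zero]
      refine integral_congr_ae (Filter.Eventually.of_forall fun y => ?_)
      -- Translation by `e_i` carries the face `x_i = 0` onto the face `x_i = 1`.
      have hp := hφ.periodic (Pi.single i 1) (i.insertNth 0 y)
      simp only [if_true]
      rw [← hp]
      congr 1
      ext l
      refine Fin.succAboveCases i ?_ (fun l => ?_) l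
      · simp
      · simp
    · simp [hi]
  · intro i
    by_cases hi : i = j
    · simpa [hi] using hφ.smooth.continuous.continuousOn
    · simp only [hi, if_false]
      exact continuousOn_const
  · intro x _ i
    by_cases hi : i = j
    · simpa [hi] using (hφ.differentiable x).hasFDerivAt
    · simp only [hi, if_false]
      exact hasFDerivAt_const (0 : ℝ) x
  · refine Continuous.integrableOn_Icc ?_
    refine continuous_finsetSum _ fun i _ => ?_
    by_cases hi : i = j
    · simp only [hi, if_true]
      exact hφ.continuous_partialDeriv j
    · simpa [hi] using continuous_const

theorem IsTest.hasWeakPartial {φ : (Fin n → ℝ) → ℝ} (hφ : IsTest φ) (j : Fin n) :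
    HasWeakPartial j φ (partialDeriv j φ) := by
  intro ψ hψ
  have h := (hφ.mul hψ).integral_partialDeriv j
  simp only [hφ.partialDeriv_mul hψ] at h
  rw [integral_add] at h
  · linarith
  · exact (memLp_of_continuous hφ.smooth.continuous).integrable_mul
      (memLp_of_continuous (hψ.continuous_partialDeriv j))
  · exact (memLp_of_continuous (hφ.continuous_partialDeriv j)).integrable_mul
      (memLp_of_continuous hψ.smooth.continuous)

/-- The phase `2π k·x`, as a continuous linear form. -/
def phase (k : Fin n → ℤ) : (Fin n → ℝ) →L[ℝ] ℝ :=
  ∑ i, (2 * Real.pi * k i) • ContinuousLinearMap.proj (R := ℝ) i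

theorem phase_apply (k : Fin n → ℤ) (x : Fin n → ℝ) :
    phase k x = 2 * Real.pi * ∑ i, k i * x i := by
  simp [phase, Finset.mul_sum, mul_assoc]

theorem phase_single (k : Fin n → ℤ) (j : Fin n) :
    phase k (Pi.single j 1) = 2 * Real.pi * k j := by
  rw [phase_apply, Finset.sum_eq_single j]
  · simp
  · intro i _ hi
    simp [hi]
  · simp

theorem phase_add_int (k l : Fin n → ℤ) (x : Fin n → ℝ) :
    phase k (fun i => x i + (l i : ℝ)) = phase k x + (∑ i, k i * l i : ℤ) * (2 * Real.pi) := by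
  simp only [phase_apply, mul_add, Finset.sum_add_distrib]
  push_cast
  ring

theorem isTest_cos (k : Fin n → ℤ) : IsTest fun x => Real.cos (phase k x) :=
  ⟨Real.contDiff_cos.comp (phase k).contDiff, fun l x => by
    rw [phase_add_int, Real.cos_add_int_mul_two_pi]⟩

theorem isTest_sin (k : Fin n → ℤ) : IsTest fun x => Real.sin (phase k x) :=
  ⟨Real.contDiff_sin.comp (phase k).contDiff, fun l x => by
    rw [phase_add_int, Real.sin_add_int_mul_two_pi]⟩

theorem partialDeriv_cos (k : Fin n → ℤ) (j : Fin n) (x : Fin n → ℝ) :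
    partialDeriv j (fun x => Real.cos (phase k x)) x =
      -(2 * Real.pi * k j) * Real.sin (phase k x) := by
  rw [partialDeriv, ((phase k).hasFDerivAt.cos (x := x)).fderiv]
  simp [phase_single]
  ring

theorem partialDeriv_sin (k : Fin n → ℤ) (j : Fin n) (x : Fin n → ℝ) :
    partialDeriv j (fun x => Real.sin (phase k x)) x =
      (2 * Real.pi * k j) * Real.cos (phase k x) := by
  rw [partialDeriv, ((phase k).hasFDerivAt.sin (x := x)).fderiv]
  simp [phase_single]
  ring

theorem conj_char (k : Fin n → ℤ) (x : Fin n → ℝ) :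
    conj (char k x) = Real.cos (phase k x) - Complex.I * Real.sin (phase k x) := by
  have : char k x = Complex.exp ((phase k x : ℝ) * Complex.I) := by
    rw [char, phase_apply]
    push_cast
    ring_nf
  rw [this, Complex.exp_mul_I, ← Complex.ofReal_cos, ← Complex.ofReal_sin, map_add, map_mul,
    Complex.conj_ofReal, Complex.conj_ofReal, Complex.conj_I]
  ring

/-- Test functions are real-valued, so a character can enter the definition of a weak derivative
only through its cosine and sine. -/
theorem fhat_eq {u : (Fin n → ℝ) → ℝ} (hu : MemLp u 2 (μY n)) (k : Fin n → ℤ) :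
    fhat u k = (∫ x, u x * Real.cos (phase k x) ∂(μY n) : ℝ) -
      Complex.I * (∫ x, u x * Real.sin (phase k x) ∂(μY n) : ℝ) := by
  have hc := hu.integrable_mul (memLp_of_continuous (isTest_cos k).smooth.continuous)
  have hs := hu.integrable_mul (memLp_of_continuous (isTest_sin k).smooth.continuous)
  rw [fhat, ← integral_complex_ofReal, ← integral_complex_ofReal, ← integral_const_mul,
    ← integral_sub hc.ofReal (hs.ofReal.const_mul _)]
  refine integral_congr_ae (Filter.Eventually.of_forall fun x => ?_)
  simp only [conj_char]
  push_cast
  ring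

theorem HasWeakPartial.fhat {j : Fin n} {u v : (Fin n → ℝ) → ℝ} (h : HasWeakPartial j u v)
    (hu : MemLp u 2 (μY n)) (hv : MemLp v 2 (μY n)) (k : Fin n → ℤ) :
    fhat v k = (2 * Real.pi * k j : ℝ) * Complex.I * fhat u k := by
  have h1 := h _ (isTest_cos k)
  have h2 := h _ (isTest_sin k)
  simp only [partialDeriv_cos, partialDeriv_sin, mul_left_comm (u _)] at h1 h2
  rw [integral_const_mul] at h1 h2
  rw [fhat_eq hv, fhat_eq hu, ← neg_eq_iff_eq_neg.mpr h1, ← neg_eq_iff_eq_neg.mpr h2]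
  push_cast
  linear_combination (2 * (Real.pi : ℂ) * (k j : ℂ) *
    ((∫ x, u x * Real.sin (phase k x) ∂(μY n) : ℝ) : ℂ)) * Complex.I_sq

theorem fhat_zero (u : (Fin n → ℝ) → ℝ) : fhat u 0 = (∫ x, u x ∂(μY n) : ℝ) := by
  simp [fhat, char, integral_complex_ofReal]

end TestFunctions

/-! ### Commuting weak derivatives and Poincaré's inequality. -/

section WeakDerivatives

variable {n : ℕ}

theorem ae_eq_of_fhat_eq {u v : (Fin n → ℝ) → ℝ} (hu : MemLp u 2 (μY n)) (hv : MemLp v 2 (μY n))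
    (h : ∀ k, fhat u k = fhat v k) : u =ᵐ[μY n] v := by
  have h0 : u - v =ᵐ[μY n] 0 := by
    refine ae_eq_zero_of_fhat_eq_zero (hu.sub hv) fun k => ?_
    have e : ∀ φ : (Fin n → ℝ) → ℝ, IsTest φ → ∫ x, (u - v) x * φ x ∂(μY n) =
        (∫ x, u x * φ x ∂(μY n)) - ∫ x, v x * φ x ∂(μY n) := by
      intro φ hφ
      have hφ' := memLp_of_continuous hφ.smooth.continuous
      simp only [Pi.sub_apply, sub_mul]
      exact integral_sub (hu.integrable_mul hφ') (hv.integrable_mul hφ')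
    have hk := h k
    rw [fhat_eq hu, fhat_eq hv] at hk
    rw [fhat_eq (hu.sub hv), e _ (isTest_cos k), e _ (isTest_sin k)]
    push_cast
    linear_combination hk
  filter_upwards [h0] with x hx
  exact sub_eq_zero.mp hx

theorem hasSum_sq_norm_fhat {u : (Fin n → ℝ) → ℝ} (hu : MemLp u 2 (μY n)) :
    HasSum (fun k => ‖fhat u k‖ ^ 2) (∫ x, u x * u x ∂(μY n)) := by
  have h := hasSum_fhat_mul hu hu
  rw [← Complex.hasSum_ofReal]
  convert h using 2 with k
  rw [Complex.conj_mul']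
  push_cast
  rfl

/-- Exchanging the derivatives in `∫ ∂_j a ∂_l b`. -/
theorem integral_mul_weakPartial_comm {j l : Fin n} {a b aj al bj bl : (Fin n → ℝ) → ℝ}
    (ha : MemLp a 2 (μY n)) (hb : MemLp b 2 (μY n))
    (haj : MemLp aj 2 (μY n)) (hal : MemLp al 2 (μY n))
    (hbj : MemLp bj 2 (μY n)) (hbl : MemLp bl 2 (μY n))
    (h1 : HasWeakPartial j a aj) (h2 : HasWeakPartial l a al)
    (h3 : HasWeakPartial j b bj) (h4 : HasWeakPartial l b bl) :
    ∫ x, aj x * bl x ∂(μY n) = ∫ x, al x * bj x ∂(μY n) := by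
  have e1 := hasSum_fhat_mul haj hbl
  have e2 := hasSum_fhat_mul hal hbj
  -- Both products equal `(2π)² k_j k_l` times `conj(fhat a k) * fhat b k`.
  have e : (fun k => conj (fhat aj k) * fhat bl k) = fun k => conj (fhat al k) * fhat bj k := by
    funext k
    rw [h1.fhat ha haj, h2.fhat ha hal, h3.fhat hb hbj, h4.fhat hb hbl]
    simp only [map_mul, Complex.conj_ofReal]
    push_cast
    ring
  rw [e] at e1
  exact_mod_cast e1.unique e2

theorem weakPartial_comm {i j : Fin n} {φ gi gj hij hji : (Fin n → ℝ) → ℝ}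
    (hφ : MemLp φ 2 (μY n)) (hgi : MemLp gi 2 (μY n)) (hgj : MemLp gj 2 (μY n))
    (hhij : MemLp hij 2 (μY n)) (hhji : MemLp hji 2 (μY n))
    (h1 : HasWeakPartial i φ gi) (h2 : HasWeakPartial j φ gj)
    (h3 : HasWeakPartial j gi hij) (h4 : HasWeakPartial i gj hji) :
    hij =ᵐ[μY n] hji := by
  refine ae_eq_of_fhat_eq hhij hhji fun k => ?_
  rw [h3.fhat hgi hhij, h4.fhat hgj hhji, h1.fhat hφ hgi, h2.fhat hφ hgj]
  ring

theorem one_le_sum_sq_of_ne_zero {k : Fin n → ℤ} (hk : k ≠ 0) : (1 : ℝ) ≤ ∑ j, (k j : ℝ) ^ 2 := by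
  obtain ⟨j, hj⟩ := Function.ne_iff.mp hk
  have h1 : (1 : ℤ) ≤ k j ^ 2 := Order.one_le_iff_pos.mpr (sq_pos_of_ne_zero hj)
  have h2 : (1 : ℝ) ≤ (k j : ℝ) ^ 2 := by exact_mod_cast h1
  exact h2.trans (Finset.single_le_sum (f := fun j => (k j : ℝ) ^ 2)
    (fun i _ => sq_nonneg _) (Finset.mem_univ j))

/-- Poincaré's inequality for periodic functions of mean zero. -/
theorem poincare {u : (Fin n → ℝ) → ℝ} {g : Fin n → (Fin n → ℝ) → ℝ} (hu : MemLp u 2 (μY n))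
    (hg : ∀ j, MemLp (g j) 2 (μY n)) (h : ∀ j, HasWeakPartial j u (g j))
    (h0 : ∫ x, u x ∂(μY n) = 0) :
    (2 * Real.pi) ^ 2 * ∫ x, u x * u x ∂(μY n) ≤ ∑ j, ∫ x, g j x * g j x ∂(μY n) := by
  refine hasSum_le (fun k => ?_) ((hasSum_sq_norm_fhat hu).mul_left _)
    (hasSum_sum fun j _ => hasSum_sq_norm_fhat (hg j))
  have e : ∀ j, ‖fhat (g j) k‖ ^ 2 = (2 * Real.pi) ^ 2 * ‖fhat u k‖ ^ 2 * (k j : ℝ) ^ 2 := by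
    intro j
    rw [(h j).fhat hu (hg j), norm_mul, norm_mul, Complex.norm_I, Complex.norm_real,
      Real.norm_eq_abs, mul_one, mul_pow, sq_abs]
    ring
  simp only [e, ← Finset.mul_sum]
  -- The mean-zero condition removes the frequency `0`; every other integer frequency has `|k|² ≥
  -- 1`.
  by_cases hk : k = 0
  · subst hk
    simp [fhat_zero, h0]
  · exact le_mul_of_one_le_right (by positivity) (one_le_sum_sq_of_ne_zero hk)

end WeakDerivatives

/-! ### Density of Laplacians among mean-zero functions. -/

section Laplacian

variable {n : ℕ}

/-- The classical Laplacian. -/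
def lap (φ : (Fin n → ℝ) → ℝ) (x : Fin n → ℝ) : ℝ := ∑ i, partialDeriv i (partialDeriv i φ) x

theorem IsTest.add {φ ψ : (Fin n → ℝ) → ℝ} (hφ : IsTest φ) (hψ : IsTest ψ) : IsTest (φ + ψ) :=
  ⟨hφ.smooth.add hψ.smooth, fun k x => by
    simp only [Pi.add_apply, hφ.periodic k x, hψ.periodic k x]⟩

theorem IsTest.smul {φ : (Fin n → ℝ) → ℝ} (c : ℝ) (hφ : IsTest φ) : IsTest (c • φ) :=
  ⟨hφ.smooth.const_smul c, fun k x => by simp only [Pi.smul_apply, hφ.periodic k x]⟩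

theorem IsTest.partialDeriv_add {φ ψ : (Fin n → ℝ) → ℝ} (hφ : IsTest φ) (hψ : IsTest ψ)
    (j : Fin n) : partialDeriv j (φ + ψ) = partialDeriv j φ + partialDeriv j ψ := by
  ext x
  simp [partialDeriv, fderiv_add (hφ.differentiable x) (hψ.differentiable x)]

theorem IsTest.partialDeriv_smul {φ : (Fin n → ℝ) → ℝ} (c : ℝ) (hφ : IsTest φ)
    (j : Fin n) : partialDeriv j (c • φ) = c • partialDeriv j φ := by
  ext x
  simp [partialDeriv, fderiv_const_smul (hφ.differentiable x)]

theorem IsTest.lap_add {φ ψ : (Fin n → ℝ) → ℝ} (hφ : IsTest φ) (hψ : IsTest ψ) :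
    lap (φ + ψ) = lap φ + lap ψ := by
  ext x
  simp [lap, hφ.partialDeriv_add hψ, (hφ.isTest_partialDeriv _).partialDeriv_add
    (hψ.isTest_partialDeriv _), Finset.sum_add_distrib]

theorem IsTest.lap_smul {φ : (Fin n → ℝ) → ℝ} (c : ℝ) (hφ : IsTest φ) :
    lap (c • φ) = c • lap φ := by
  ext x
  simp [lap, hφ.partialDeriv_smul c, (hφ.isTest_partialDeriv _).partialDeriv_smul c,
    Finset.mul_sum]

theorem IsTest.continuous_lap {φ : (Fin n → ℝ) → ℝ} (hφ : IsTest φ) : Continuous (lap φ) :=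
  continuous_finsetSum _ fun i _ => (hφ.isTest_partialDeriv i).continuous_partialDeriv i

theorem lap_cos (k : Fin n → ℤ) (x : Fin n → ℝ) :
    lap (fun x => Real.cos (phase k x)) x =
      -((2 * Real.pi) ^ 2 * ∑ j, (k j : ℝ) ^ 2) * Real.cos (phase k x) := by
  have e : ∀ j, partialDeriv j (fun x => Real.cos (phase k x)) =
      (-(2 * Real.pi * k j)) • fun x => Real.sin (phase k x) := fun j =>
    funext (partialDeriv_cos k j)
  simp only [lap, e, (isTest_sin k).partialDeriv_smul, Pi.smul_apply, partialDeriv_sin,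
    smul_eq_mul, Finset.mul_sum, Finset.sum_mul, ← Finset.sum_neg_distrib]
  exact Finset.sum_congr rfl fun j _ => by ring

theorem lap_sin (k : Fin n → ℤ) (x : Fin n → ℝ) :
    lap (fun x => Real.sin (phase k x)) x =
      -((2 * Real.pi) ^ 2 * ∑ j, (k j : ℝ) ^ 2) * Real.sin (phase k x) := by
  have e : ∀ j, partialDeriv j (fun x => Real.sin (phase k x)) =
      (2 * Real.pi * k j) • fun x => Real.cos (phase k x) := fun j =>
    funext (partialDeriv_sin k j)
  simp only [lap, e, (isTest_cos k).partialDeriv_smul, Pi.smul_apply, partialDeriv_cos,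
    smul_eq_mul, Finset.mul_sum, Finset.sum_mul, ← Finset.sum_neg_distrib]
  exact Finset.sum_congr rfl fun j _ => by ring

/-- The Laplacians of smooth periodic functions, in `L²`. -/
def lapRange (n : ℕ) : Submodule ℝ (L2per n ℝ) where
  carrier := {f | ∃ ψ, IsTest ψ ∧ f =ᵐ[μY n] lap ψ}
  add_mem' := by
    rintro f g ⟨φ, hφ, hf⟩ ⟨ψ, hψ, hg⟩
    refine ⟨φ + ψ, hφ.add hψ, ?_⟩
    rw [hφ.lap_add hψ]
    exact (Lp.coeFn_add f g).trans (hf.add hg)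
  zero_mem' := by
    refine ⟨(0 : ℝ) • fun _ => 1, isTest_one.smul 0, ?_⟩
    rw [isTest_one.lap_smul, zero_smul]
    exact Lp.coeFn_zero _ _ _
  smul_mem' := by
    rintro c f ⟨φ, hφ, hf⟩
    refine ⟨c • φ, hφ.smul c, ?_⟩
    rw [hφ.lap_smul]
    exact (Lp.coeFn_smul c f).trans (hf.const_smul c)

theorem inner_L2per (u v : L2per n ℝ) : inner ℝ u v = ∫ x, u x * v x ∂(μY n) := by
  rw [L2.inner_def]
  exact integral_congr_ae (Filter.Eventually.of_forall fun x => by simp [mul_comm])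

/-- The cosine and sine of frequency `k` are eigenfunctions of the Laplacian with eigenvalue
`-4π²|k|²`, which is nonzero. -/
theorem fhat_eq_zero_of_mem_orthogonal {f : L2per n ℝ} (hf : f ∈ (lapRange n)ᗮ) {k : Fin n → ℤ}
    (hk : k ≠ 0) : fhat f k = 0 := by
  have key : ∀ φ : (Fin n → ℝ) → ℝ, IsTest φ →
      (∀ x, lap φ x = -((2 * Real.pi) ^ 2 * ∑ j, (k j : ℝ) ^ 2) * φ x) →
      ∫ x, f x * φ x ∂(μY n) = 0 := by
    intro φ hφ hl
    have hm := memLp_of_continuous hφ.continuous_lap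
    have h := (Submodule.mem_orthogonal' _ _).mp hf (hm.toLp _) ⟨φ, hφ, hm.coeFn_toLp⟩
    rw [inner_L2per] at h
    have e : ∫ x, f x * hm.toLp _ x ∂(μY n) =
        -((2 * Real.pi) ^ 2 * ∑ j, (k j : ℝ) ^ 2) * ∫ x, f x * φ x ∂(μY n) := by
      rw [← integral_const_mul]
      refine integral_congr_ae ?_
      filter_upwards [hm.coeFn_toLp] with x hx
      rw [hx, hl]
      ring
    rw [e] at h
    refine (mul_eq_zero.mp h).resolve_left ?_
    have := one_le_sum_sq_of_ne_zero hk
    have := Real.pi_pos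
    exact neg_ne_zero.mpr (by positivity)
  rw [fhat_eq (Lp.memLp f), key _ (isTest_cos k) (lap_cos k), key _ (isTest_sin k) (lap_sin k)]
  simp

/-- The closure is the double orthogonal complement. An element of the first complement has only the
frequency `0`, which a mean-zero function lacks, so Parseval makes the two orthogonal. -/
theorem mem_closure_lapRange {u : L2per n ℝ} (hu : ∫ x, u x ∂(μY n) = 0) :
    u ∈ (lapRange n).topologicalClosure := by
  rw [← Submodule.orthogonal_orthogonal_eq_closure, Submodule.mem_orthogonal]
  intro f hf
  have h := hasSum_fhat_mul (Lp.memLp f) (Lp.memLp u)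
  have e : (fun k => conj (fhat f k) * fhat u k) = fun _ => 0 := by
    funext k
    by_cases hk : k = 0
    · subst hk
      simp [fhat_zero, hu]
    · simp [fhat_eq_zero_of_mem_orthogonal hf hk]
  rw [e] at h
  rw [inner_L2per]
  exact_mod_cast h.unique hasSum_zero

end Laplacian

/-! ### The pointwise Cordes estimate and the perturbation of the divergence. -/

section Cordes

variable {n : ℕ} {lam Lam δ : ℝ} {A : (Fin n → ℝ) → Matrix (Fin n) (Fin n) ℝ}
  {b : (Fin n → ℝ) → Vec n}

/-- `Ã - I`, as an element of the Frobenius space. -/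
def AtilSubOne (A : (Fin n → ℝ) → Matrix (Fin n) (Fin n) ℝ) (b : (Fin n → ℝ) → Vec n)
    (x : Fin n → ℝ) : Mat n :=
  WithLp.toLp 2 fun p => Atil A b x p.1 p.2 - if p.1 = p.2 then 1 else 0

theorem trL_apply (G : Mat n) : trL n G = ∑ i, G (i, i) := by
  simp [trL]

theorem inner_mat (M N : Mat n) : inner ℝ M N = ∑ i, ∑ j, M (i, j) * N (i, j) := by
  simp [PiLp.inner_apply, Fintype.sum_prod_type, mul_comm]

theorem renOp_eq (g : L2per n (Vec n)) (G : L2per n (Mat n)) (x : Fin n → ℝ) :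
    renOp A b g G x =
      trL n (G x) + (inner ℝ (AtilSubOne A b x) (G x) + inner ℝ (btil A b x) (g x)) := by
  have h : frob (Atil A b x) (toMatrix (G x)) = trL n (G x) + inner ℝ (AtilSubOne A b x) (G x) := by
    rw [trL_apply, inner_mat, ← Finset.sum_add_distrib, frob]
    refine Finset.sum_congr rfl fun i _ => ?_
    simp [AtilSubOne, sub_mul, toMatrix]
  rw [renOp, h, add_assoc]

theorem norm_sq_mat (M : Mat n) : ‖M‖ ^ 2 = ∑ i, ∑ j, M (i, j) ^ 2 := by
  rw [← real_inner_self_eq_norm_sq, inner_mat]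
  simp only [sq]

theorem norm_sq_AtilSubOne (x : Fin n → ℝ) :
    ‖AtilSubOne A b x‖ ^ 2 =
      gam A b x ^ 2 * frob (A x) (A x) - 2 * gam A b x * (A x).trace + n := by
  have h : ∀ i j, AtilSubOne A b x (i, j) ^ 2 = gam A b x ^ 2 * (A x i j * A x i j) -
      2 * gam A b x * (if i = j then A x i j else 0) + if i = j then 1 else 0 := by
    intro i j
    simp only [AtilSubOne, Atil, Matrix.smul_apply, smul_eq_mul]
    split_ifs <;> ring
  rw [norm_sq_mat]
  simp only [h, Finset.sum_add_distrib, Finset.sum_sub_distrib, ← Finset.mul_sum, frob,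
    Finset.sum_ite_eq, Finset.mem_univ, if_true, Matrix.trace, Matrix.diag]
  simp

theorem norm_sq_btil (x : Fin n → ℝ) : ‖btil A b x‖ ^ 2 = gam A b x ^ 2 * ‖b x‖ ^ 2 := by
  rw [btil, norm_smul, mul_pow, Real.norm_eq_abs, sq_abs]

/-- The Cordes condition bounds the distance of the renormalized operator to the divergence. -/
theorem SettingB.norm_sq_add_le (hn : 0 < n) (h : SettingB lam Lam δ A b) :
    ∀ᵐ x ∂(μY n), ‖AtilSubOne A b x‖ ^ 2 + ‖btil A b x‖ ^ 2 ≤ 1 - δ := by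
  refine ae_restrict_of_ae ?_
  filter_upwards [h.elliptic, h.cordes] with x he hc
  have hn1 : (1 : ℝ) ≤ n := by exact_mod_cast hn
  -- Testing ellipticity with unit vectors bounds the diagonal below, so `tr A` and `|A|²` are
  -- positive and the quotients are genuine.
  have hdiag : ∀ i, lam ≤ A x i i := by
    intro i
    have := (he (Pi.single i 1)).1
    simpa using this
  have htr : 0 < (A x).trace := by
    have : Nonempty (Fin n) := ⟨⟨0, hn⟩⟩
    exact Finset.sum_pos (fun i _ => h.lam_pos.trans_le (hdiag i)) Finset.univ_nonempty
  have hf : 0 < frob (A x) (A x) := by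
    have h1 : A x ⟨0, hn⟩ ⟨0, hn⟩ * A x ⟨0, hn⟩ ⟨0, hn⟩ ≤ frob (A x) (A x) := by
      refine le_trans ?_ (Finset.single_le_sum (fun i _ => Finset.sum_nonneg fun j _ =>
        mul_self_nonneg _) (Finset.mem_univ (⟨0, hn⟩ : Fin n)))
      exact Finset.single_le_sum (f := fun j => A x ⟨0, hn⟩ j * A x ⟨0, hn⟩ j)
        (fun j _ => mul_self_nonneg _) (Finset.mem_univ _)
    have h2 := h.lam_pos.trans_le (hdiag ⟨0, hn⟩)
    exact (mul_pos h2 h2).trans_le h1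
  have hδ : 0 < δ := lt_of_le_of_lt (by positivity) h.lt_δ
  have hS : 0 < frob (A x) (A x) + ‖b x‖ ^ 2 := by positivity
  rw [norm_sq_AtilSubOne, norm_sq_btil, gam]
  rw [div_le_div_iff₀ (by positivity) (by linarith), one_mul] at hc
  have h3 : (n : ℝ) - 1 + δ ≤ (A x).trace ^ 2 / (frob (A x) (A x) + ‖b x‖ ^ 2) := by
    rw [le_div_iff₀ hS]
    linarith
  -- With `S = |A|² + |b|²` the left side is `γ²S - 2γ tr A + n`; the choice `γ = tr A / S`
  -- minimizes this quadratic.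
  have h4 : ((A x).trace / (frob (A x) (A x) + ‖b x‖ ^ 2)) ^ 2 * frob (A x) (A x) -
      2 * ((A x).trace / (frob (A x) (A x) + ‖b x‖ ^ 2)) * (A x).trace + n +
      ((A x).trace / (frob (A x) (A x) + ‖b x‖ ^ 2)) ^ 2 * ‖b x‖ ^ 2 =
      n - (A x).trace ^ 2 / (frob (A x) (A x) + ‖b x‖ ^ 2) := by
    field_simp
    ring
  rw [h4]
  linarith

/-- Cauchy–Schwarz in the plane for `(p, q)` and `(s, t)`; it handles the matrix and vector parts
with one joint constant. -/
theorem add_mul_sq_le {p q s t a c : ℝ} (ha : |a| ≤ p * s) (hc : |c| ≤ q * t) :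
    (a + c) ^ 2 ≤ (p ^ 2 + q ^ 2) * (s ^ 2 + t ^ 2) := by
  have h1 : |a + c| ≤ p * s + q * t := (abs_add_le a c).trans (add_le_add ha hc)
  have h2 : (a + c) ^ 2 ≤ (p * s + q * t) ^ 2 := sq_le_sq' (by linarith [neg_abs_le (a + c)])
    ((le_abs_self _).trans h1)
  nlinarith [sq_nonneg (p * t - q * s)]

theorem SettingB.sq_inner_le (hn : 0 < n) (h : SettingB lam Lam δ A b) :
    ∀ᵐ x ∂(μY n), ∀ (g : Vec n) (G : Mat n),
      (inner ℝ (AtilSubOne A b x) G + inner ℝ (btil A b x) g) ^ 2 ≤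
        (1 - δ) * (‖G‖ ^ 2 + ‖g‖ ^ 2) := by
  filter_upwards [h.norm_sq_add_le hn] with x hx g G
  refine (add_mul_sq_le (abs_real_inner_le_norm _ _) (abs_real_inner_le_norm _ _)).trans ?_
  exact mul_le_mul_of_nonneg_right hx (by positivity)

theorem SettingB.aemeasurable_A (h : SettingB lam Lam δ A b) (i j : Fin n) :
    AEMeasurable (fun x => A x i j) (μY n) :=
  (h.linfty_A i j).1.1.aemeasurable.restrict

theorem SettingB.aemeasurable_b (h : SettingB lam Lam δ A b) (i : Fin n) :
    AEMeasurable (fun x => b x i) (μY n) :=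
  (h.linfty_b i).1.1.aemeasurable.restrict

theorem SettingB.aemeasurable_gam (h : SettingB lam Lam δ A b) :
    AEMeasurable (gam A b) (μY n) := by
  have hA := h.aemeasurable_A
  have hb := h.aemeasurable_b
  have h1 : AEMeasurable (fun x => (A x).trace) (μY n) := by
    simp only [Matrix.trace, Matrix.diag]
    exact Finset.aemeasurable_fun_sum _ fun i _ => hA i i
  have h2 : AEMeasurable (fun x => frob (A x) (A x)) (μY n) := by
    simp only [frob]
    exact Finset.aemeasurable_fun_sum _ fun i _ =>
      Finset.aemeasurable_fun_sum _ fun j _ => (hA i j).mul (hA i j)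
  have h3 : AEMeasurable (fun x => ‖b x‖ ^ 2) (μY n) := by
    simp only [EuclideanSpace.real_norm_sq_eq]
    exact Finset.aemeasurable_fun_sum _ fun i _ => (hb i).pow_const 2
  exact h1.div (h2.add h3)

theorem SettingB.aestronglyMeasurable_AtilSubOne (h : SettingB lam Lam δ A b) :
    AEStronglyMeasurable (AtilSubOne A b) (μY n) := by
  refine AEMeasurable.aestronglyMeasurable ?_
  refine (WithLp.measurable_toLp 2 _).comp_aemeasurable (aemeasurable_pi_lambda _ fun p => ?_)
  exact (h.aemeasurable_gam.mul (h.aemeasurable_A p.1 p.2)).sub_const _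

theorem SettingB.aestronglyMeasurable_btil (h : SettingB lam Lam δ A b) :
    AEStronglyMeasurable (btil A b) (μY n) := by
  refine AEMeasurable.aestronglyMeasurable ?_
  refine h.aemeasurable_gam.smul ?_
  exact (WithLp.measurable_toLp 2 _).comp_aemeasurable
    (f := fun x i => b x i) (aemeasurable_pi_lambda _ h.aemeasurable_b)

/-- The perturbation `Ã:G + b̃·g - tr G`. -/
def pert (A : (Fin n → ℝ) → Matrix (Fin n) (Fin n) ℝ) (b : (Fin n → ℝ) → Vec n)
    (g : L2per n (Vec n)) (G : L2per n (Mat n)) (x : Fin n → ℝ) : ℝ :=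
  inner ℝ (AtilSubOne A b x) (G x) + inner ℝ (btil A b x) (g x)

theorem integral_norm_sq {E : Type} [NormedAddCommGroup E] [InnerProductSpace ℝ E]
    (f : L2per n E) : ∫ x, ‖f x‖ ^ 2 ∂(μY n) = ‖f‖ ^ 2 := by
  rw [← real_inner_self_eq_norm_sq, L2.inner_def]
  simp only [real_inner_self_eq_norm_sq]

theorem SettingB.memLp_pert (hn : 0 < n) (h : SettingB lam Lam δ A b) (g : L2per n (Vec n))
    (G : L2per n (Mat n)) : MemLp (pert A b g G) 2 (μY n) := by
  have hδ : 0 < δ := lt_of_le_of_lt (by positivity) h.lt_δ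
  refine ((Lp.memLp G).norm.add (Lp.memLp g).norm).mono
    ((h.aestronglyMeasurable_AtilSubOne.inner (Lp.aestronglyMeasurable G)).add
      (h.aestronglyMeasurable_btil.inner (Lp.aestronglyMeasurable g))) ?_
  filter_upwards [h.sq_inner_le hn] with x hx
  simp only [Pi.add_apply, Real.norm_eq_abs]
  refine sq_le_sq.mp ((hx (g x) (G x)).trans ?_)
  nlinarith [norm_nonneg (G x), norm_nonneg (g x), mul_nonneg (norm_nonneg (G x)) (norm_nonneg (g x)),
    mul_nonneg hδ.le (sq_nonneg ‖G x‖), mul_nonneg hδ.le (sq_nonneg ‖g x‖)]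

theorem SettingB.norm_sq_pert_le (hn : 0 < n) (h : SettingB lam Lam δ A b) (g : L2per n (Vec n))
    (G : L2per n (Mat n)) :
    ‖(h.memLp_pert hn g G).toLp‖ ^ 2 ≤ (1 - δ) * (‖G‖ ^ 2 + ‖g‖ ^ 2) := by
  have hG : Integrable (fun x => ‖G x‖ ^ 2) (μY n) := (Lp.memLp G).integrable_norm_pow (by norm_num)
  have hg : Integrable (fun x => ‖g x‖ ^ 2) (μY n) := (Lp.memLp g).integrable_norm_pow (by norm_num)
  rw [← integral_norm_sq G, ← integral_norm_sq g, ← integral_add hG hg, ← integral_const_mul,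
    ← integral_norm_sq]
  refine integral_mono_ae ((Lp.memLp _).integrable_norm_pow (by norm_num))
    ((hG.add hg).const_mul _) ?_
  filter_upwards [h.sq_inner_le hn, (h.memLp_pert hn g G).coeFn_toLp] with x hx hx'
  rw [hx', Real.norm_eq_abs, sq_abs]
  exact hx _ _

end Cordes

/-! ### The Hilbert space `H1per0` and its div–curl identity. -/

section Sobolev

variable {n : ℕ}

/-- The coordinate `f_i`, as a map on `L²`. -/
def coordL (n : ℕ) {ι : Type} [Fintype ι] (i : ι) : L2per n (EuclideanSpace ℝ ι) →L[ℝ] L2per n ℝ :=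
  (EuclideanSpace.proj (𝕜 := ℝ) i).compLpL 2 (μY n)

theorem coeFn_coordL {ι : Type} [Fintype ι] (i : ι) (f : L2per n (EuclideanSpace ℝ ι)) :
    coordL n i f =ᵐ[μY n] fun x => f x i :=
  ContinuousLinearMap.coeFn_compLpL _ _

theorem integral_coord_mul {ι : Type} [Fintype ι] (i : ι) (f : L2per n (EuclideanSpace ℝ ι))
    {ψ : (Fin n → ℝ) → ℝ} (hψ : MemLp ψ 2 (μY n)) :
    ∫ x, f x i * ψ x ∂(μY n) = inner ℝ (coordL n i f) (hψ.toLp ψ) := by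
  rw [inner_L2per]
  refine integral_congr_ae ?_
  filter_upwards [coeFn_coordL i f, hψ.coeFn_toLp] with x h1 h2
  rw [h1, h2]

theorem continuous_integral_coord_mul {ι : Type} [Fintype ι] (i : ι) {ψ : (Fin n → ℝ) → ℝ}
    (hψ : MemLp ψ 2 (μY n)) :
    Continuous fun f : L2per n (EuclideanSpace ℝ ι) => ∫ x, f x i * ψ x ∂(μY n) := by
  simp only [integral_coord_mul i _ hψ]
  exact (coordL n i).continuous.inner continuous_const

theorem integral_apply {ι : Type} [Fintype ι] (f : L2per n (EuclideanSpace ℝ ι)) (i : ι) :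
    (∫ x, f x ∂(μY n)) i = ∫ x, f x i ∂(μY n) :=
  ((EuclideanSpace.proj (𝕜 := ℝ) i).integral_comp_comm
    ((Lp.memLp f).integrable (by norm_num))).symm

theorem integral_eq_zero_iff_coord (f : L2per n (Vec n)) :
    ∫ x, f x ∂(μY n) = 0 ↔ ∀ i, ∫ x, f x i ∂(μY n) = 0 := by
  simp only [← integral_apply]
  exact ⟨fun h i => by rw [h]; rfl, fun h => PiLp.ext h⟩

/-- For each fixed test function the defining condition equates two continuous functionals.
Completeness, needed for Lax–Milgram, follows. -/
theorem isClosed_H1per0 : IsClosed (H1per0 n : Set (WithLp 2 (L2per n (Vec n) × L2per n (Mat n)))) := by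
  have hf : Continuous fun p : WithLp 2 (L2per n (Vec n) × L2per n (Mat n)) => p.fst :=
    (WithLp.prod_continuous_ofLp 2 _ _).fst
  have hs : Continuous fun p : WithLp 2 (L2per n (Vec n) × L2per n (Mat n)) => p.snd :=
    (WithLp.prod_continuous_ofLp 2 _ _).snd
  have h1 : IsClosed {p : WithLp 2 (L2per n (Vec n) × L2per n (Mat n)) |
      HasWeakJac p.fst p.snd} := by
    simp only [HasWeakJac, HasWeakPartial, Set.ofPred_forall]
    refine isClosed_iInter fun i => isClosed_iInter fun j => isClosed_iInter fun φ =>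
      isClosed_iInter fun hφ => isClosed_eq ?_ ?_
    · exact (continuous_integral_coord_mul i
        (memLp_of_continuous (hφ.continuous_partialDeriv j))).comp hf
    · exact ((continuous_integral_coord_mul (i, j)
        (memLp_of_continuous hφ.smooth.continuous)).comp hs).neg
  have h2 : IsClosed {p : WithLp 2 (L2per n (Vec n) × L2per n (Mat n)) |
      ∫ x, p.fst x ∂(μY n) = 0} := by
    simp only [integral_eq_zero_iff_coord, Set.ofPred_forall]
    refine isClosed_iInter fun i => isClosed_eq ?_ continuous_const
    have := (continuous_integral_coord_mul (n := n) i
      (memLp_of_continuous (continuous_const (y := (1 : ℝ))))).comp hf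
    simpa [Function.comp_def] using this
  exact h1.inter h2

instance instCompleteH1per0 : CompleteSpace (H1per0 n) :=
  isClosed_H1per0.completeSpace_coe

theorem norm_sq_H1per0 (w : H1per0 n) : ‖w‖ ^ 2 = ‖fn w‖ ^ 2 + ‖D w‖ ^ 2 :=
  WithLp.prod_norm_sq_eq_of_L2 w.1

theorem norm_fn_le (w : H1per0 n) : ‖fn w‖ ≤ ‖w‖ :=
  le_of_sq_le_sq (by nlinarith [norm_sq_H1per0 w, sq_nonneg ‖D w‖]) (norm_nonneg _)

theorem norm_D_le (w : H1per0 n) : ‖D w‖ ≤ ‖w‖ :=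
  le_of_sq_le_sq (by nlinarith [norm_sq_H1per0 w, sq_nonneg ‖fn w‖]) (norm_nonneg _)

/-- `w ↦ w` as a map into `L²`. -/
def fnL (n : ℕ) : H1per0 n →L[ℝ] L2per n (Vec n) :=
  LinearMap.mkContinuous ⟨⟨fn, fun _ _ => rfl⟩, fun _ _ => rfl⟩ 1 fun w => by
    rw [one_mul]
    exact norm_fn_le w

/-- `w ↦ Dw` as a continuous linear map. -/
def DL (n : ℕ) : H1per0 n →L[ℝ] L2per n (Mat n) :=
  LinearMap.mkContinuous ⟨⟨D, fun _ _ => rfl⟩, fun _ _ => rfl⟩ 1 fun w => by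
    rw [one_mul]
    exact norm_D_le w

/-- `w ↦ ∇·w` as a continuous linear map. -/
def divL (n : ℕ) : H1per0 n →L[ℝ] L2per n ℝ :=
  ((trL n).compLpL 2 (μY n)).comp (DL n)

theorem coeFn_div (w : H1per0 n) : div w =ᵐ[μY n] fun x => trL n (D w x) :=
  ContinuousLinearMap.coeFn_compLp _ _

theorem memLp_D (w : H1per0 n) (p : Fin n × Fin n) : MemLp (fun x => D w x p) 2 (μY n) :=
  memLp_coord (D w) p

theorem memLp_fn (w : H1per0 n) (i : Fin n) : MemLp (fun x => fn w x i) 2 (μY n) :=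
  memLp_coord (fn w) i

theorem integral_sum_sum {f : Fin n → Fin n → (Fin n → ℝ) → ℝ}
    (h : ∀ i j, Integrable (f i j) (μY n)) :
    ∫ x, ∑ i, ∑ j, f i j x ∂(μY n) = ∑ i, ∑ j, ∫ x, f i j x ∂(μY n) := by
  rw [integral_finsetSum _ fun i _ => integrable_finsetSum _ fun j _ => h i j]
  exact Finset.sum_congr rfl fun i _ => integral_finsetSum _ fun j _ => h i j

theorem inner_L2mat (f g : L2per n (Mat n)) :
    inner ℝ f g = ∑ i, ∑ j, ∫ x, f x (i, j) * g x (i, j) ∂(μY n) := by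
  have h : ∀ i j, Integrable (fun x => f x (i, j) * g x (i, j)) (μY n) := fun i j =>
    (memLp_coord f (i, j)).integrable_mul (memLp_coord g (i, j))
  rw [L2.inner_def]
  simp only [inner_mat]
  exact integral_sum_sum h

/-- The derivatives in `∫ ∂_i v_i ∂_j w_j` are exchanged, with no boundary term because of
periodicity. -/
theorem inner_div (v w : H1per0 n) :
    inner ℝ (div v) (div w) = ∑ i, ∑ j, ∫ x, D v x (i, j) * D w x (j, i) ∂(μY n) := by
  have h : ∀ p q, Integrable (fun x => D v x p * D w x q) (μY n) := fun p q =>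
    (memLp_D v p).integrable_mul (memLp_D w q)
  have h1 : ∫ x, div v x * div w x ∂(μY n) =
      ∫ x, ∑ i, ∑ j, D v x (i, i) * D w x (j, j) ∂(μY n) := by
    refine integral_congr_ae ?_
    filter_upwards [coeFn_div v, coeFn_div w] with x h1 h2
    rw [h1, h2, trL_apply, trL_apply, Finset.sum_mul_sum]
  rw [inner_L2per, h1, integral_sum_sum fun i j => h (i, i) (j, j)]
  refine Finset.sum_congr rfl fun i _ => Finset.sum_congr rfl fun j _ => ?_
  exact integral_mul_weakPartial_comm (memLp_fn v i) (memLp_fn w j) (memLp_D v (i, i))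
    (memLp_D v (i, j)) (memLp_D w (j, i)) (memLp_D w (j, j)) (v.2.1 i i) (v.2.1 i j)
    (w.2.1 j i) (w.2.1 j j)

/-- `½ ∫ (Dv - Dvᵀ) : (Dw - Dwᵀ) = ∫ Dv : Dw - ∫ (∇·v)(∇·w)`. -/
theorem half_integral_skew (v w : H1per0 n) :
    (1 / 2) * ∫ x, frob (toMatrix (D v x) - (toMatrix (D v x)).transpose)
      (toMatrix (D w x) - (toMatrix (D w x)).transpose) ∂(μY n) =
    inner ℝ (D v) (D w) - inner ℝ (div v) (div w) := by
  have h : ∀ p q, Integrable (fun x => D v x p * D w x q) (μY n) := fun p q =>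
    (memLp_D v p).integrable_mul (memLp_D w q)
  have e : ∀ x, frob (toMatrix (D v x) - (toMatrix (D v x)).transpose)
      (toMatrix (D w x) - (toMatrix (D w x)).transpose) =
      ∑ i, ∑ j, 2 * (D v x (i, j) * D w x (i, j) - D v x (i, j) * D w x (j, i)) := by
    intro x
    have e1 : ∀ i j, (toMatrix (D v x) - (toMatrix (D v x)).transpose) i j *
        (toMatrix (D w x) - (toMatrix (D w x)).transpose) i j =
        (D v x (i, j) * D w x (i, j) - D v x (i, j) * D w x (j, i)) +
        (D v x (j, i) * D w x (j, i) - D v x (j, i) * D w x (i, j)) := by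
      intro i j
      simp only [toMatrix, Matrix.sub_apply, Matrix.transpose_apply, Matrix.of_apply]
      ring
    simp only [frob, e1, Finset.sum_add_distrib]
    -- Renaming the indices turns the second half of the sum into the first, which produces the
    -- factor 2.
    rw [Finset.sum_comm (f := fun i j => D v x (j, i) * D w x (j, i) - D v x (j, i) * D w x (i, j))]
    simp only [two_mul, Finset.sum_add_distrib]
  have h2 : ∀ i j, Integrable (fun x => 2 * (D v x (i, j) * D w x (i, j) -
      D v x (i, j) * D w x (j, i))) (μY n) := fun i j => ((h _ _).sub (h _ _)).const_mul 2
  simp only [e]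
  rw [inner_L2mat, inner_div, integral_sum_sum h2, Finset.mul_sum,
    ← Finset.sum_sub_distrib]
  refine Finset.sum_congr rfl fun i _ => ?_
  rw [Finset.mul_sum, ← Finset.sum_sub_distrib]
  refine Finset.sum_congr rfl fun j _ => ?_
  rw [integral_const_mul, integral_sub (h _ _) (h _ _)]
  ring

/-- The gap `‖Dw‖² - ‖∇·w‖²` is half the integral of a squared skew part. Having constant 1 here,
rather than `√n`, keeps the coercivity threshold at `κ < 1`. -/
theorem norm_div_le (w : H1per0 n) : ‖div w‖ ≤ ‖D w‖ := by
  have h := half_integral_skew w w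
  rw [real_inner_self_eq_norm_sq, real_inner_self_eq_norm_sq] at h
  have h0 : 0 ≤ ∫ x, frob (toMatrix (D w x) - (toMatrix (D w x)).transpose)
      (toMatrix (D w x) - (toMatrix (D w x)).transpose) ∂(μY n) :=
    integral_nonneg fun x => Finset.sum_nonneg fun i _ => Finset.sum_nonneg fun j _ =>
      mul_self_nonneg _
  exact le_of_sq_le_sq (by linarith) (norm_nonneg _)

theorem integral_fn_coord (w : H1per0 n) (i : Fin n) : ∫ x, fn w x i ∂(μY n) = 0 :=
  (integral_eq_zero_iff_coord _).mp w.2.2 i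

theorem poincare_H1per0 (w : H1per0 n) : (2 * Real.pi) ^ 2 * ‖fn w‖ ^ 2 ≤ ‖D w‖ ^ 2 := by
  have h1 : ‖fn w‖ ^ 2 = ∑ i, ∫ x, fn w x i * fn w x i ∂(μY n) := by
    rw [← integral_norm_sq]
    simp only [EuclideanSpace.real_norm_sq_eq, ← sq]
    exact integral_finsetSum _ fun i _ => (memLp_fn w i).integrable_sq
  rw [h1, ← real_inner_self_eq_norm_sq, inner_L2mat, Finset.mul_sum]
  exact Finset.sum_le_sum fun i _ => poincare (memLp_fn w i) (fun j => memLp_D w (i, j))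
    (w.2.1 i) (integral_fn_coord w i)

theorem HasWeakPartial.integral_eq_zero {j : Fin n} {u v : (Fin n → ℝ) → ℝ}
    (h : HasWeakPartial j u v) : ∫ x, v x ∂(μY n) = 0 := by
  have := h _ isTest_one
  simpa [partialDeriv_one] using this

theorem integral_div (w : H1per0 n) : ∫ x, div w x ∂(μY n) = 0 := by
  rw [integral_congr_ae (coeFn_div w)]
  simp only [trL_apply]
  rw [integral_finsetSum _ fun i _ => (memLp_D w (i, i)).integrable (by norm_num)]
  exact Finset.sum_eq_zero fun i _ => (w.2.1 i i).integral_eq_zero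

/-- The gradient of an `H²_per` function, as an element of `H¹_{per,0}`. -/
def gradH1 {φ : L2per n ℝ} {g : L2per n (Vec n)} {H : L2per n (Mat n)}
    (hg : HasWeakGrad φ g) (hH : HasWeakJac g H) : H1per0 n :=
  ⟨WithLp.toLp 2 (g, H), hH, (integral_eq_zero_iff_coord g).mpr fun i => (hg i).integral_eq_zero⟩

/-- For gradients the skew part of the weak Jacobian vanishes. -/
theorem inner_D_gradH1 {φ : L2per n ℝ} {g : L2per n (Vec n)} {H : L2per n (Mat n)}
    (hg : HasWeakGrad φ g) (hH : HasWeakJac g H) (v : H1per0 n) :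
    inner ℝ (D v) (D (gradH1 hg hH)) = inner ℝ (div v) (div (gradH1 hg hH)) := by
  rw [inner_L2mat, inner_div]
  refine Finset.sum_congr rfl fun i _ => Finset.sum_congr rfl fun j _ => integral_congr_ae ?_
  filter_upwards [weakPartial_comm (Lp.memLp φ) (memLp_coord g i) (memLp_coord g j)
    (memLp_coord H (i, j)) (memLp_coord H (j, i)) (hg i) (hg j) (hH i j) (hH j i)] with x hx
  exact congrArg _ hx

end Sobolev

/-! ### Lax–Milgram on closed subspaces. -/

section LaxMilgram

theorem existsUnique_of_isCoercive {V : Type*} [NormedAddCommGroup V] [InnerProductSpace ℝ V]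
    [CompleteSpace V] {B : V →L[ℝ] V →L[ℝ] ℝ} (hB : IsCoercive B) (l : V →L[ℝ] ℝ) :
    ∃! u, ∀ w, B u w = l w := by
  refine ⟨hB.continuousLinearEquivOfBilin.symm ((InnerProductSpace.toDual ℝ V).symm l),
    fun w => ?_, fun u hu => ?_⟩
  · rw [← hB.continuousLinearEquivOfBilin_apply, ContinuousLinearEquiv.apply_symm_apply,
      InnerProductSpace.toDual_symm_apply]
  · rw [ContinuousLinearEquiv.eq_symm_apply]
    refine ext_inner_right ℝ fun w => ?_
    rw [hB.continuousLinearEquivOfBilin_apply, hu, InnerProductSpace.toDual_symm_apply]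

/-- Coercivity passes to every subspace with the same constant, and a closed subspace is again
complete. -/
theorem existsUnique_mem_of_coercive {V : Type*} [NormedAddCommGroup V] [InnerProductSpace ℝ V]
    [CompleteSpace V] (B : V →L[ℝ] V →L[ℝ] ℝ) {c : ℝ} (hc : 0 < c)
    (hB : ∀ u, c * ‖u‖ * ‖u‖ ≤ B u u) (l : V →L[ℝ] ℝ) (P : Submodule ℝ V)
    (hP : IsClosed (P : Set V)) : ∃! u, u ∈ P ∧ ∀ w ∈ P, B u w = l w := by
  have : CompleteSpace P := hP.completeSpace_coe
  have hco : IsCoercive (B.bilinearComp P.subtypeL P.subtypeL) := ⟨c, hc, fun u => hB u⟩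
  obtain ⟨u, hu, huniq⟩ := existsUnique_of_isCoercive hco (l.comp P.subtypeL)
  refine ⟨u, ⟨u.2, fun w hw => hu ⟨w, hw⟩⟩, fun v hv => ?_⟩
  exact congrArg Subtype.val (huniq ⟨v, hv.1⟩ fun w => hv.2 w w.2)

end LaxMilgram

/-! ### Smooth periodic functions as very weak test functions. -/

section Gradients

variable {n : ℕ}

theorem memLp_toLp {ι : Type} [Fintype ι] {f : ι → (Fin n → ℝ) → ℝ}
    (hf : ∀ i, MemLp (f i) 2 (μY n)) :
    MemLp (fun x => (WithLp.toLp 2 fun i => f i x : EuclideanSpace ℝ ι)) 2 (μY n) :=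
  MemLp.of_eval_piLp hf

theorem IsTest.exists_grad {ψ : (Fin n → ℝ) → ℝ} (hψ : IsTest ψ) :
    ∃ (φ : L2per n ℝ) (g : L2per n (Vec n)) (H : L2per n (Mat n)),
      HasWeakGrad φ g ∧ HasWeakJac g H ∧ (fun x => trL n (H x)) =ᵐ[μY n] lap ψ := by
  have h0 := memLp_of_continuous hψ.smooth.continuous
  have h1 := memLp_toLp fun i : Fin n => memLp_of_continuous (hψ.continuous_partialDeriv i)
  have h2 := memLp_toLp fun p : Fin n × Fin n =>
    memLp_of_continuous ((hψ.isTest_partialDeriv p.1).continuous_partialDeriv p.2)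
  refine ⟨h0.toLp _, h1.toLp _, h2.toLp _, fun j => ?_, fun i j => ?_, ?_⟩
  · refine (hψ.hasWeakPartial j).congr h0.coeFn_toLp ?_
    filter_upwards [h1.coeFn_toLp] with x hx
    rw [hx]
  · refine ((hψ.isTest_partialDeriv i).hasWeakPartial j).congr ?_ ?_
    · filter_upwards [h1.coeFn_toLp] with x hx
      rw [hx]
    · filter_upwards [h2.coeFn_toLp] with x hx
      rw [hx]
  · filter_upwards [h2.coeFn_toLp] with x hx
    rw [hx, trL_apply]
    rfl

end Gradients

/-! ### The form `B₂`: coercivity, very weak solutions and Céa's lemma. -/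

section Form

variable {n : ℕ} {lam Lam δ : ℝ} {A : (Fin n → ℝ) → Matrix (Fin n) (Fin n) ℝ}
  {b : (Fin n → ℝ) → Vec n}

/-- The relative size `((1 - δ)(1 + n/π²))^{1/2}` of the perturbation of the divergence. -/
def cordesConst (n : ℕ) (δ : ℝ) : ℝ := Real.sqrt ((1 - δ) * (1 + n / Real.pi ^ 2))

theorem cordesConst_nonneg : 0 ≤ cordesConst n δ := Real.sqrt_nonneg _

/-- After clearing denominators, `κ² < 1` reads `(1 - δ)(n + π²) < π²`, which is the hypothesis on
`δ`. -/
theorem cordesConst_lt_one (h : (n : ℝ) / (n + Real.pi ^ 2) < δ) : cordesConst n δ < 1 := by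
  have hp : 0 < Real.pi ^ 2 := by positivity
  rw [cordesConst, Real.sqrt_lt' one_pos, one_pow]
  rw [div_lt_iff₀ (by positivity)] at h
  have e : (1 - δ) * (1 + n / Real.pi ^ 2) = (1 - δ) * (n + Real.pi ^ 2) / Real.pi ^ 2 := by
    field_simp
    ring
  rw [e, div_lt_one hp]
  linarith

theorem SettingB.norm_pert_le (hn : 0 < n) (h : SettingB lam Lam δ A b) (w : H1per0 n) :
    ‖(h.memLp_pert hn (fn w) (D w)).toLp‖ ≤ cordesConst n δ * ‖D w‖ := by
  have hn1 : (1 : ℝ) ≤ n := by exact_mod_cast hn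
  have hp : 0 < Real.pi ^ 2 := by positivity
  have h1 := h.norm_sq_pert_le hn (fn w) (D w)
  -- Poincaré's inequality gives the factor `1/(4π²)`; the larger `n/π²` is the one that matches the
  -- threshold for `δ`.
  have h2 : ‖fn w‖ ^ 2 ≤ n / Real.pi ^ 2 * ‖D w‖ ^ 2 := by
    rw [div_mul_eq_mul_div, le_div_iff₀ hp]
    have h3 := poincare_H1per0 w
    nlinarith [mul_nonneg hp.le (sq_nonneg ‖fn w‖),
      mul_nonneg (sub_nonneg.mpr hn1) (sq_nonneg ‖D w‖)]
  have hδ : 0 ≤ 1 - δ := sub_nonneg.mpr h.δ_le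
  refine le_of_sq_le_sq (h1.trans ?_) (mul_nonneg cordesConst_nonneg (norm_nonneg _))
  rw [mul_pow, cordesConst, Real.sq_sqrt (by positivity), mul_assoc]
  refine mul_le_mul_of_nonneg_left ?_ hδ
  linarith

/-- The perturbation `w ↦ Ã:Dw + b̃·w - ∇·w` as an operator. -/
def SettingB.pertL (hn : 0 < n) (h : SettingB lam Lam δ A b) : H1per0 n →L[ℝ] L2per n ℝ :=
  LinearMap.mkContinuous
    { toFun := fun w => (h.memLp_pert hn (fn w) (D w)).toLp
      map_add' := fun v w => by
        rw [← MemLp.toLp_add, MemLp.toLp_eq_toLp_iff]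
        filter_upwards [Lp.coeFn_add (fn v) (fn w), Lp.coeFn_add (D v) (D w)] with x h1 h2
        have e1 : fn (v + w) = fn v + fn w := rfl
        have e2 : D (v + w) = D v + D w := rfl
        simp only [pert, e1, e2, h1, h2, Pi.add_apply, inner_add_right]
        ring
      map_smul' := fun c w => by
        rw [RingHom.id_apply, ← MemLp.toLp_const_smul, MemLp.toLp_eq_toLp_iff]
        filter_upwards [Lp.coeFn_smul c (fn w), Lp.coeFn_smul c (D w)] with x h1 h2
        have e1 : fn (c • w) = c • fn w := rfl
        have e2 : D (c • w) = c • D w := rfl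
        simp only [pert, e1, e2, h1, h2, Pi.smul_apply, inner_smul_right, smul_eq_mul]
        ring }
    (cordesConst n δ) fun w => (h.norm_pert_le hn w).trans
      (mul_le_mul_of_nonneg_left (norm_D_le w) cordesConst_nonneg)

theorem SettingB.norm_pertL_le (hn : 0 < n) (h : SettingB lam Lam δ A b) (w : H1per0 n) :
    ‖h.pertL hn w‖ ≤ cordesConst n δ * ‖D w‖ :=
  h.norm_pert_le hn w

theorem SettingB.integral_mul_renOp (hn : 0 < n) (h : SettingB lam Lam δ A b) (u : L2per n ℝ)
    (w : H1per0 n) :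
    ∫ x, u x * renOp A b (fn w) (D w) x ∂(μY n) =
      inner ℝ u (div w) + inner ℝ u (h.pertL hn w) := by
  rw [← inner_add_right, inner_L2per]
  refine integral_congr_ae ?_
  filter_upwards [Lp.coeFn_add (div w) (h.pertL hn w), coeFn_div w,
    (h.memLp_pert hn (fn w) (D w)).coeFn_toLp] with x h1 h2 h3
  have h4 : h.pertL hn w x = pert A b (fn w) (D w) x := h3
  rw [h1, Pi.add_apply, h2, h4, renOp_eq, pert]

/-- The form `B₂` as a bounded bilinear form. -/
def SettingB.formL (hn : 0 < n) (h : SettingB lam Lam δ A b) : H1per0 n →L[ℝ] H1per0 n →L[ℝ] ℝ :=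
  (innerSL ℝ).bilinearComp (DL n) (DL n) + (innerSL ℝ).bilinearComp (divL n) (h.pertL hn)

theorem SettingB.formL_apply (hn : 0 < n) (h : SettingB lam Lam δ A b) (v w : H1per0 n) :
    h.formL hn v w = inner ℝ (D v) (D w) + inner ℝ (div v) (h.pertL hn w) := rfl

/-- The term `∫ (∇·v)(∇·w)` from the trace part of the operator cancels the one subtracted in
`half_integral_skew`. -/
theorem SettingB.B2_eq (hn : 0 < n) (h : SettingB lam Lam δ A b) (v w : H1per0 n) :
    B2 A b v w = h.formL hn v w := by
  rw [B2, h.integral_mul_renOp hn, half_integral_skew, h.formL_apply]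
  ring

theorem SettingB.abs_inner_pertL_le (hn : 0 < n) (h : SettingB lam Lam δ A b) (u : L2per n ℝ)
    (w : H1per0 n) : |inner ℝ u (h.pertL hn w)| ≤ cordesConst n δ * (‖u‖ * ‖D w‖) := by
  refine (abs_real_inner_le_norm _ _).trans ?_
  have := mul_le_mul_of_nonneg_left (h.norm_pertL_le hn w) (norm_nonneg u)
  linarith

theorem SettingB.abs_formL_le (hn : 0 < n) (h : SettingB lam Lam δ A b) (v w : H1per0 n) :
    |h.formL hn v w| ≤ (1 + cordesConst n δ) * (‖D v‖ * ‖D w‖) := by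
  have h1 := abs_real_inner_le_norm (D v) (D w)
  have h2 := h.abs_inner_pertL_le hn (div v) w
  have h3 : cordesConst n δ * (‖div v‖ * ‖D w‖) ≤ cordesConst n δ * (‖D v‖ * ‖D w‖) :=
    mul_le_mul_of_nonneg_left (mul_le_mul_of_nonneg_right (norm_div_le v) (norm_nonneg _))
      cordesConst_nonneg
  rw [h.formL_apply]
  refine (abs_add_le _ _).trans ?_
  linarith

theorem SettingB.le_formL_self (hn : 0 < n) (h : SettingB lam Lam δ A b) (w : H1per0 n) :
    (1 - cordesConst n δ) * ‖D w‖ ^ 2 ≤ h.formL hn w w := by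
  have h2 := (abs_le.mp (h.abs_inner_pertL_le hn (div w) w)).1
  have h3 : cordesConst n δ * (‖div w‖ * ‖D w‖) ≤ cordesConst n δ * (‖D w‖ * ‖D w‖) :=
    mul_le_mul_of_nonneg_left (mul_le_mul_of_nonneg_right (norm_div_le w) (norm_nonneg _))
      cordesConst_nonneg
  rw [h.formL_apply, real_inner_self_eq_norm_sq]
  nlinarith

theorem norm_sq_le_two_mul (w : H1per0 n) : ‖w‖ ^ 2 ≤ 2 * ‖D w‖ ^ 2 := by
  have h1 := poincare_H1per0 w
  have h2 : (1 : ℝ) ≤ (2 * Real.pi) ^ 2 := by nlinarith [Real.pi_gt_three]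
  have h3 := mul_le_mul_of_nonneg_right h2 (sq_nonneg ‖fn w‖)
  rw [norm_sq_H1per0]
  linarith

theorem SettingB.le_formL_norm (hn : 0 < n) (h : SettingB lam Lam δ A b) (w : H1per0 n) :
    (1 - cordesConst n δ) / 2 * ‖w‖ * ‖w‖ ≤ h.formL hn w w := by
  refine le_trans ?_ (h.le_formL_self hn w)
  have h1 := mul_le_mul_of_nonneg_left (norm_sq_le_two_mul w)
    (sub_nonneg.mpr (cordesConst_lt_one h.lt_δ).le)
  linarith

/-- The right-hand side `w ↦ -∫ F·w`. -/
def rhsL (F : L2per n (Vec n)) : H1per0 n →L[ℝ] ℝ := -(innerSL ℝ F).comp (fnL n)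

theorem rhsL_apply (F : L2per n (Vec n)) (w : H1per0 n) :
    rhsL F w = -∫ x, inner ℝ (F x) (fn w x) ∂(μY n) := by
  rw [← L2.inner_def]
  rfl

theorem SettingB.isVarSol_iff (hn : 0 < n) (h : SettingB lam Lam δ A b) (F : L2per n (Vec n))
    (P : Submodule ℝ (H1per0 n)) (ρ : H1per0 n) :
    IsVarSol A b F P ρ ↔ ρ ∈ P ∧ ∀ w ∈ P, h.formL hn ρ w = rhsL F w := by
  simp only [IsVarSol, h.B2_eq hn, rhsL_apply]

theorem SettingB.existsUnique_isVarSol (hn : 0 < n) (h : SettingB lam Lam δ A b)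
    (F : L2per n (Vec n)) (P : Submodule ℝ (H1per0 n)) (hP : IsClosed (P : Set (H1per0 n))) :
    ∃! ρ : H1per0 n, IsVarSol A b F P ρ := by
  simp only [h.isVarSol_iff hn]
  exact existsUnique_mem_of_coercive (h.formL hn)
    (half_pos (sub_pos.mpr (cordesConst_lt_one h.lt_δ))) (h.le_formL_norm hn) (rhsL F) P hP

theorem SettingB.isVeryWeakSol_neg_div (hn : 0 < n) (h : SettingB lam Lam δ A b)
    {F : L2per n (Vec n)} {ρ : H1per0 n} (hρ : IsVarSol A b F ⊤ ρ) :
    IsVeryWeakSol A b F (-div ρ) := by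
  refine ⟨fun φ g H hg hH => ?_, ?_⟩
  -- The variational equation is tested with `∇φ`, for which the Dirichlet term becomes `∫ (∇·ρ)Δφ`.
  · have h1 := ((h.isVarSol_iff hn F ⊤ ρ).mp hρ).2 (gradH1 hg hH) trivial
    rw [h.formL_apply, inner_D_gradH1, rhsL_apply] at h1
    have h2 := h.integral_mul_renOp hn (-div ρ) (gradH1 hg hH)
    rw [inner_neg_left, inner_neg_left] at h2
    have h3 : ∫ x, (-div ρ : L2per n ℝ) x * renOp A b g H x ∂(μY n) =
      ∫ x, inner ℝ (F x) (fn (gradH1 hg hH) x) ∂(μY n) := h2.trans (by linarith)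
    exact h3
  · rw [integral_congr_ae (Lp.coeFn_neg (div ρ))]
    simp only [Pi.neg_apply]
    rw [integral_neg, integral_div, neg_zero]

/-- Only `0` is orthogonal to the range of the renormalized operator. -/
theorem SettingB.eq_zero_of_forall_integral (hn : 0 < n) (h : SettingB lam Lam δ A b)
    {u : L2per n ℝ} (h0 : ∫ x, u x ∂(μY n) = 0)
    (hu : ∀ (φ : L2per n ℝ) (g : L2per n (Vec n)) (H : L2per n (Mat n)),
      HasWeakGrad φ g → HasWeakJac g H → ∫ x, u x * renOp A b g H x ∂(μY n) = 0) : u = 0 := by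
  have key : ∀ f ∈ lapRange n, |inner ℝ u f| ≤ cordesConst n δ * (‖u‖ * ‖f‖) := by
    rintro f ⟨ψ, hψ, hf⟩
    obtain ⟨φ, g, H, hg, hH, htr⟩ := hψ.exists_grad
    have e : div (gradH1 hg hH) = f := by
      refine Lp.ext ?_
      exact (coeFn_div _).trans (htr.trans hf.symm)
    have h1 := h.integral_mul_renOp hn u (gradH1 hg hH)
    have h2 : inner ℝ u (div (gradH1 hg hH)) + inner ℝ u (h.pertL hn (gradH1 hg hH)) = 0 :=
      h1.symm.trans (hu φ g H hg hH)
    -- For gradients `‖D²φ‖ = ‖Δφ‖`, so the perturbation is controlled by `f` alone.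
    have h3 : ‖D (gradH1 hg hH)‖ = ‖f‖ := by
      have := inner_D_gradH1 hg hH (gradH1 hg hH)
      rw [real_inner_self_eq_norm_sq, real_inner_self_eq_norm_sq, e] at this
      exact (sq_eq_sq₀ (norm_nonneg _) (norm_nonneg _)).mp this
    have h4 := h.abs_inner_pertL_le hn u (gradH1 hg hH)
    rw [e] at h2
    rwa [h3, ← neg_eq_of_add_eq_zero_right h2, abs_neg] at h4
  -- The bound survives passage to the closure of the Laplacians, which contains the mean-zero
  -- function `u` itself.
  have hcl : IsClosed {f : L2per n ℝ | |inner ℝ u f| ≤ cordesConst n δ * (‖u‖ * ‖f‖)} :=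
    isClosed_le (continuous_const.inner continuous_id).abs (by fun_prop)
  have h1 : |inner ℝ u u| ≤ cordesConst n δ * (‖u‖ * ‖u‖) :=
    closure_minimal key hcl (mem_closure_lapRange h0)
  rw [real_inner_self_eq_norm_sq, abs_of_nonneg (sq_nonneg _)] at h1
  have h2 := cordesConst_lt_one h.lt_δ
  by_contra hne
  have h3 : 0 < ‖u‖ := norm_pos_iff.mpr hne
  nlinarith [mul_pos h3 h3]

theorem SettingB.memLp_renOp (hn : 0 < n) (h : SettingB lam Lam δ A b) (g : L2per n (Vec n))
    (G : L2per n (Mat n)) : MemLp (renOp A b g G) 2 (μY n) := by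
  have e : renOp A b g G = fun x => trL n (G x) + pert A b g G x := funext fun x => renOp_eq g G x
  rw [e]
  exact ((trL n).comp_memLp G).add (h.memLp_pert hn g G)

theorem SettingB.isVeryWeakSol_unique (hn : 0 < n) (h : SettingB lam Lam δ A b)
    {F : L2per n (Vec n)} {u v : L2per n ℝ} (hu : IsVeryWeakSol A b F u)
    (hv : IsVeryWeakSol A b F v) : u = v := by
  refine sub_eq_zero.mp (h.eq_zero_of_forall_integral hn ?_ fun φ g H hg hH => ?_)
  · rw [integral_congr_ae (Lp.coeFn_sub u v)]
    simp only [Pi.sub_apply]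
    rw [integral_sub ((Lp.memLp u).integrable (by norm_num))
      ((Lp.memLp v).integrable (by norm_num)), hu.2, hv.2, sub_zero]
  · have hm := h.memLp_renOp hn g H
    have e : ∫ x, (u - v : L2per n ℝ) x * renOp A b g H x ∂(μY n) =
        ∫ x, (u x * renOp A b g H x - v x * renOp A b g H x) ∂(μY n) := by
      refine integral_congr_ae ?_
      filter_upwards [Lp.coeFn_sub u v] with x hx
      rw [hx, Pi.sub_apply, sub_mul]
    have e2 : ∫ x, (u x * renOp A b g H x - v x * renOp A b g H x) ∂(μY n) =
        (∫ x, u x * renOp A b g H x ∂(μY n)) - ∫ x, v x * renOp A b g H x ∂(μY n) :=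
      integral_sub ((Lp.memLp u).integrable_mul hm) ((Lp.memLp v).integrable_mul hm)
    rw [e, e2, hu.1 φ g H hg hH, hv.1 φ g H hg hH, sub_self]

/-- Céa's lemma for `B₂` with respect to the seminorm `‖D·‖`. -/
theorem SettingB.norm_D_sub_le (hn : 0 < n) (h : SettingB lam Lam δ A b) {F : L2per n (Vec n)}
    {P : Submodule ℝ (H1per0 n)} {ρ ρh : H1per0 n} (hρ : IsVarSol A b F ⊤ ρ)
    (hρh : IsVarSol A b F P ρh) {w : H1per0 n} (hw : w ∈ P) :
    ‖D (ρ - ρh)‖ ≤ (1 + cordesConst n δ) / (1 - cordesConst n δ) * ‖D (ρ - w)‖ := by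
  rw [h.isVarSol_iff hn] at hρ hρh
  have hκ := cordesConst_lt_one h.lt_δ
  -- Galerkin orthogonality, as `w - ρh` lies in `P`.
  have hz : h.formL hn (ρ - ρh) (w - ρh) = 0 := by
    rw [map_sub (h.formL hn), sub_apply, hρ.2 _ trivial, hρh.2 _ (P.sub_mem hw hρh.1), sub_self]
  have h1 : h.formL hn (ρ - ρh) (ρ - ρh) = h.formL hn (ρ - ρh) (ρ - w) := by
    rw [← sub_add_sub_cancel ρ w ρh, map_add (h.formL hn (ρ - w + (w - ρh))),
      sub_add_sub_cancel ρ w ρh, hz, add_zero]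
  have h2 := h.le_formL_self hn (ρ - ρh)
  have h3 := (le_abs_self _).trans (h.abs_formL_le hn (ρ - ρh) (ρ - w))
  rw [div_mul_eq_mul_div, le_div_iff₀ (by linarith)]
  rcases (norm_nonneg (D (ρ - ρh))).eq_or_lt with h0 | h0
  · rw [← h0, zero_mul]
    have := cordesConst_nonneg (n := n) (δ := δ)
    positivity
  · refine le_of_mul_le_mul_left ?_ h0
    linarith

end Form

end

end FPK

/-! ### The main theorem. -/

theorem theorem3p4 (n : ℕ) (hn : 0 < n) (lam Lam δ : ℝ) :
    ∃ C : ℝ, 0 < C ∧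
      ∀ (A : (Fin n → ℝ) → Matrix (Fin n) (Fin n) ℝ) (b : (Fin n → ℝ) → FPK.Vec n),
        FPK.SettingB lam Lam δ A b →
      ∀ F : FPK.L2per n (FPK.Vec n),
        (∃! ρ₀ : FPK.H1per0 n, FPK.IsVarSol A b F ⊤ ρ₀) ∧
        (∃! u₀ : FPK.L2per n ℝ, FPK.IsVeryWeakSol A b F u₀) ∧
        ∀ (ρ₀ : FPK.H1per0 n) (u₀ : FPK.L2per n ℝ),
          FPK.IsVarSol A b F ⊤ ρ₀ → FPK.IsVeryWeakSol A b F u₀ →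
          u₀ = -FPK.div ρ₀ ∧
          ∀ P : Submodule ℝ (FPK.H1per0 n), IsClosed (P : Set (FPK.H1per0 n)) →
            (∃! ρh : FPK.H1per0 n, FPK.IsVarSol A b F P ρh) ∧
            ∀ ρh : FPK.H1per0 n, FPK.IsVarSol A b F P ρh →
              ‖u₀ - (-FPK.div ρh)‖ ≤ C * ⨅ w : P, ‖FPK.D (ρ₀ - (w : FPK.H1per0 n))‖ := by
  -- The constant is fixed before `A` and `b`. When `δ` misses the threshold no admissible
  -- coefficients exist, and any positive constant serves.
  by_cases hδ : (n : ℝ) / (n + Real.pi ^ 2) < δ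
  swap
  · exact ⟨1, one_pos, fun A b h => absurd h.lt_δ hδ⟩
  have hκ := FPK.cordesConst_lt_one hδ
  have hκ0 := FPK.cordesConst_nonneg (n := n) (δ := δ)
  have hC : 0 < (1 + FPK.cordesConst n δ) / (1 - FPK.cordesConst n δ) :=
    div_pos (by linarith) (by linarith)
  refine ⟨_, hC, fun A b h F => ?_⟩
  have hex := h.existsUnique_isVarSol hn F ⊤ isClosed_univ
  refine ⟨hex, ?_, fun ρ₀ u₀ hρ₀ hu₀ => ?_⟩
  · obtain ⟨ρ, hρ, -⟩ := hex
    exact ⟨-FPK.div ρ, h.isVeryWeakSol_neg_div hn hρ, fun u hu =>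
      h.isVeryWeakSol_unique hn hu (h.isVeryWeakSol_neg_div hn hρ)⟩
  · have hu := h.isVeryWeakSol_unique hn hu₀ (h.isVeryWeakSol_neg_div hn hρ₀)
    refine ⟨hu, fun P hP => ⟨h.existsUnique_isVarSol hn F P hP, fun ρh hρh => ?_⟩⟩
    have e : ‖u₀ - -FPK.div ρh‖ = ‖FPK.div (ρ₀ - ρh)‖ := by
      have e1 : FPK.div (ρ₀ - ρh) = FPK.div ρ₀ - FPK.div ρh := map_sub (FPK.divL n) ρ₀ ρh
      rw [hu, e1, ← norm_neg]
      congr 1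
      abel
    rw [e, ← div_le_iff₀' hC]
    refine le_ciInf fun w => ?_
    rw [div_le_iff₀' hC]
    exact (FPK.norm_div_le _).trans (h.norm_D_sub_le hn hρ₀ hρh w.2)
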